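/- Let $\mathfrak g_0$ be a finite-dimensional real Lie algebra with complexification $\mathfrak g=\mathfrak g_0^{\mathbb C}$. Let $G_0$ be a connected and simply connected real Lie group with Lie algebra $\mathfrak g_0$, let $G$ be a connected and simply connected complex Lie group with Lie algebra $\mathfrak g$, and let $\iota:G_0\to G$ be the homomorphism of Lie groups whose differential is the inclusion $\mathfrak g_0\subset\mathfrak g$; $G_0$ acts on the complex dual space $\mathfrak g^*$ through $\iota$ and the coadjoint action of $G$. Let $c$ be the holomorphic linear Poisson bivector of $\mathfrak g^*$, $c_z(X,Y)=z([X,Y])$ for $X,Y\in\mathfrak g=(\mathfrak g^*)^*$, let $c_z^\sharp X=c_z(X,\cdot)$, and let $\operatorname{Sing}\mathfrak g^*$ be the union of the symplectic leaves of $c$ of nonmaximal dimension, i.e. the set of points $z$ at which the rank of $c_z^\sharp$ is not maximal. (1) Let $z_0\in\mathfrak g^*\setminus\operatorname{Sing}\mathfrak g^*$. The $G$-orbit $M=G(z_0)$ is an immersed complex submanifold of $\mathfrak g^*$ and the $G_0$-orbit $\mathcal O$ of $z_0$ is an immersed real $C^\infty$-submanifold of $\mathfrak g^*$ (both with the manifold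 structure of a homogeneous space). We have $T_xM=\operatorname{im}c_x^\sharp$ for $x\in M$, so that $M$ carries the holomorphic symplectic form $\omega=(c|_M)^{-1}$, that is, $\omega_x(c_x^\sharp X,c_x^\sharp Y)=x([X,Y])$. With respect to $\omega$, $\mathcal O$ is a $CR$-isotropic submanifold of $M$: the inclusion $\mathcal O\to M$ is a $C^\infty$ injective immersion, the dimension of $T^{1,0}_x\mathcal O=(T_x\mathcal O\otimes_{\mathbb R}\mathbb C)\cap T^{1,0}_xM$ does not depend on $x\in\mathcal O$, and $T_x^{1,0}\mathcal O\subset (T_x^{1,0}\mathcal O)^{\perp\omega(x)}$ for all $x\in\mathcal O$, where $\perp\omega(x)$ denotes the skew-orthogonal complement in $T_x^{1,0}M$. (2) Let $U\subset\mathfrak g^*$ be open and let $g$ be a holomorphic Casimir function of $c$ on $U$ (i.e. $c(g)=0$). Put $\tilde g(z)=\sum_i\overline{\frac{\partial g}{\partial z_i}(z)}\,z_i$, where $z_i$ are the linear coordinates on $\mathfrak g^*$ given by a basis of $\mathfrak g_0$. Then $\tilde g$ is $G_0$-invariant on $U$: for $z\in U$, $\tilde g(z\cdot h)=\tilde g(z)$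 for every $h$ in the connected component of $1$ in $\{h\in G_0: z\cdot h\in U\}$ (for every $h\in G_0$ if $U$ is $G_0$-invariant). -/

import Mathlib

open scoped Manifold ContDiff TensorProduct

universe u

noncomputable section

namespace CoadjointCR

/-! ### Immersed submanifolds of a vector space, and orbits -/

/-- An immersed `C^∞` submanifold (over `𝕜 = ℝ` or `ℂ`, a complex one being holomorphic) of a
finite-dimensional vector space `V`: a manifold `Carrier`, modelled on the finite-dimensional space
`Model`, with an injective immersion `incl` into `V`. (It is Hausdorff, since `incl` is continuous
and injective.) -/
structure ImmersedSubmanifold (𝕜 : Type) [RCLike 𝕜] (V : Type u) [NormedAddCommGroup V]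
    [NormedSpace 𝕜 V] where
  /-- the model vector space -/
  Model : Type
  [normed : NormedAddCommGroup Model]
  [space : NormedSpace 𝕜 Model]
  [finiteDim : FiniteDimensional 𝕜 Model]
  /-- the points -/
  Carrier : Type u
  [top : TopologicalSpace Carrier]
  [charts : ChartedSpace Model Carrier]
  [manifold : IsManifold 𝓘(𝕜, Model) ∞ Carrier]
  /-- the inclusion -/
  incl : Carrier → V
  incl_injective : Function.Injective incl
  incl_contMDiff : ContMDiff 𝓘(𝕜, Model) 𝓘(𝕜, V) ∞ incl
  incl_immersion : ∀ x, Function.Injective (mfderiv 𝓘(𝕜, Model) 𝓘(𝕜, V) incl x)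

attribute [instance] ImmersedSubmanifold.normed ImmersedSubmanifold.space
  ImmersedSubmanifold.finiteDim ImmersedSubmanifold.top ImmersedSubmanifold.charts
  ImmersedSubmanifold.manifold

/-- Let `f : H → V` be an orbit map `h ↦ z₀ · h` of a Lie group `H`. The immersed submanifold `S`
*is the orbit*, with the manifold structure of the homogeneous space, if the orbit map factors as a
surjective submersion `H → S` followed by the inclusion of `S`. In particular the image of `S` in
`V` is the orbit. This determines `S` uniquely up to a unique diffeomorphism over `V`. -/
def ImmersedSubmanifold.IsOrbit {𝕜 : Type} [RCLike 𝕜] {V : Type u} [NormedAddCommGroup V]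
    [NormedSpace 𝕜 V] (S : ImmersedSubmanifold 𝕜 V)
    (E : Type*) [NormedAddCommGroup E] [NormedSpace 𝕜 E]
    {H : Type*} [TopologicalSpace H] [ChartedSpace E H] (f : H → V) : Prop :=
  ∃ p : H → S.Carrier, Function.Surjective p ∧
    ContMDiff 𝓘(𝕜, E) 𝓘(𝕜, S.Model) ∞ p ∧
    (∀ h, Function.Surjective (mfderiv 𝓘(𝕜, E) 𝓘(𝕜, S.Model) p h)) ∧
    ∀ h, S.incl (p h) = f h

/-- The tangent space of an immersed submanifold of `V`, as a subspace of `V`. -/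
def ImmersedSubmanifold.tangentSpace {𝕜 : Type} [RCLike 𝕜] {V : Type u} [NormedAddCommGroup V]
    [NormedSpace 𝕜 V] (S : ImmersedSubmanifold 𝕜 V) (x : S.Carrier) : Submodule 𝕜 V :=
  let d : S.Model →L[𝕜] V := mfderiv 𝓘(𝕜, S.Model) 𝓘(𝕜, V) S.incl x
  LinearMap.range d.toLinearMap

/-! ### CR-geometry -/

section CR

variable (W : Type*) [AddCommGroup W] [Module ℂ W]

/-- The complex structure `𝒥` of a complex vector space `W`, as a real linear map. -/
def complexStructure : W →ₗ[ℝ] W where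
  toFun w := Complex.I • w
  map_add' := smul_add _
  map_smul' _ _ := smul_comm _ _ _

/-- `W^{1,0}`: the `i`-eigenspace of the complex structure in the complexification `ℂ ⊗_ℝ W`. -/
def oneZero : Submodule ℂ (ℂ ⊗[ℝ] W) :=
  Module.End.eigenspace ((complexStructure W).baseChange ℂ) Complex.I

variable {W}

/-- `T^{1,0} = T^ℂ ∩ W^{1,0}` for a real subspace `T` of the complex vector space `W`. -/
def oneZeroPart (T : Submodule ℝ W) : Submodule ℂ (ℂ ⊗[ℝ] W) :=
  T.baseChange ℂ ⊓ oneZero W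

/-- The `(2,0)`-form on `ℂ ⊗_ℝ W` given by a complex bilinear form on `W`: the complex bilinear
extension, whose value on `(a ⊗ v, b ⊗ w)` is `a b Ω(v, w) = Ω(a v, b w)`. -/
def twoZeroForm (Ω : W →ₗ[ℂ] W →ₗ[ℂ] ℂ) : (ℂ ⊗[ℝ] W) →ₗ[ℂ] (ℂ ⊗[ℝ] W) →ₗ[ℂ] ℂ :=
  Ω.compl₁₂ (LinearMap.liftBaseChange ℂ (LinearMap.id : W →ₗ[ℝ] W))
    (LinearMap.liftBaseChange ℂ (LinearMap.id : W →ₗ[ℝ] W))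

/-- The skew-orthogonal complement, inside `W^{1,0}`, of a subspace `A`. -/
def skewOrthogonal (Ω : W →ₗ[ℂ] W →ₗ[ℂ] ℂ) (A : Submodule ℂ (ℂ ⊗[ℝ] W)) :
    Submodule ℂ (ℂ ⊗[ℝ] W) where
  carrier := {u | u ∈ oneZero W ∧ ∀ v ∈ A, twoZeroForm Ω u v = 0}
  zero_mem' := ⟨zero_mem _, fun v _ => by simp⟩
  add_mem' ha hb := ⟨add_mem ha.1 hb.1, fun v hv => by simp [ha.2 v hv, hb.2 v hv]⟩
  smul_mem' c _ ha := ⟨Submodule.smul_mem _ c ha.1, fun v hv => by simp [ha.2 v hv]⟩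

end CR

section CRManifold

variable {EM : Type*} [NormedAddCommGroup EM] [NormedSpace ℂ EM]
  {M : Type*} [TopologicalSpace M] [ChartedSpace EM M]
  {EL : Type*} [NormedAddCommGroup EL] [NormedSpace ℝ EL]
  {L : Type*} [TopologicalSpace L] [ChartedSpace EL L]

/-- The tangent space `T_y L`, as a real subspace of the tangent space `EM` of the complex manifold
`M` at `j y`, for a map `j : L → M`. -/
def realTangent (j : L → M) (y : L) : Submodule ℝ EM :=
  let d : EL →L[ℝ] EM := mfderiv 𝓘(ℝ, EL) 𝓘(ℝ, EM) j y
  LinearMap.range d.toLinearMap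

/-- `T_y^{1,0} L ⊆ ℂ ⊗_ℝ T_{j y} M`. -/
def tangentOneZero (j : L → M) (y : L) : Submodule ℂ (ℂ ⊗[ℝ] EM) :=
  oneZeroPart (realTangent (EM := EM) (EL := EL) j y)

variable (EM EL) in
/-- `j : L → M` is a (`C^∞`, immersed) CR-submanifold of the complex manifold `M`: it is an
injective immersion and the dimension of `T^{1,0} L` is constant along `L`. -/
structure IsCRSubmanifold (j : L → M) : Prop where
  injective : Function.Injective j
  contMDiff : ContMDiff 𝓘(ℝ, EL) 𝓘(ℝ, EM) ∞ j
  immersion : ∀ y, Function.Injective (mfderiv 𝓘(ℝ, EL) 𝓘(ℝ, EM) j y)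
  finrank_const : ∃ d : ℕ, ∀ y,
    Module.finrank ℂ (tangentOneZero (EM := EM) (EL := EL) j y) = d

variable (EM EL) in
/-- `j : L → M` is a CR-isotropic submanifold with respect to the field `Ω` of complex bilinear
forms on the tangent spaces of `M`. -/
structure IsCRIsotropic (Ω : M → EM →ₗ[ℂ] EM →ₗ[ℂ] ℂ) (j : L → M) : Prop
    extends IsCRSubmanifold EM EL j where
  isotropic : ∀ y, tangentOneZero (EM := EM) (EL := EL) j y ≤
    skewOrthogonal (Ω (j y)) (tangentOneZero (EM := EM) (EL := EL) j y)

end CRManifold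

/-! ### The complex Lie group `G`, its coadjoint action and the linear Poisson structure of `𝔤*`

The Lie algebra `𝔤 = T_1 G` is by definition the model space `E` of `G`, and `𝔤*` is
`E →L[ℂ] ℂ`. -/

section Coadjoint

variable {E : Type u} [NormedAddCommGroup E] [NormedSpace ℂ E] [FiniteDimensional ℂ E]
  {G : Type*} [TopologicalSpace G] [ChartedSpace E G] [Group G]

/-- `Ad g : 𝔤 → 𝔤`, the differential of the conjugation by `g` at the identity. -/
def Ad (g : G) : E →L[ℂ] E :=
  mfderiv 𝓘(ℂ, E) 𝓘(ℂ, E) (fun x : G => g * x * g⁻¹) 1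

/-- The (right) coadjoint action `z · g = Ad*(g) z = z ∘ Ad g` on `𝔤*`. -/
def coadj (g : G) (z : E →L[ℂ] ℂ) : E →L[ℂ] ℂ := z.comp (Ad g)

variable [LieGroup 𝓘(ℂ, E) ∞ G]

variable (E G) in
/-- The Lie bracket of `𝔤`, as a bilinear map. -/
def bracket : E →ₗ[ℂ] E →ₗ[ℂ] E :=
  haveI : CompleteSpace E := FiniteDimensional.complete ℂ E
  haveI : LieGroup 𝓘(ℂ, E) (minSmoothness ℂ 3) G :=
    LieGroup.of_le (n := ∞) (by
      rw [minSmoothness_of_isRCLikeNormedField]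
      exact WithTop.coe_le_coe.2 (le_top : (3 : ℕ∞) ≤ ⊤))
  LinearMap.mk₂ ℂ
    (fun X Y => (⁅(show GroupLieAlgebra 𝓘(ℂ, E) G from X),
      (show GroupLieAlgebra 𝓘(ℂ, E) G from Y)⁆ : GroupLieAlgebra 𝓘(ℂ, E) G))
    (fun X X' Y => add_lie (L := GroupLieAlgebra 𝓘(ℂ, E) G)
      (M := GroupLieAlgebra 𝓘(ℂ, E) G) X X' Y)
    (fun c X Y => smul_lie (R := ℂ) (L := GroupLieAlgebra 𝓘(ℂ, E) G)
      (M := GroupLieAlgebra 𝓘(ℂ, E) G) c X Y)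
    (fun X Y Y' => lie_add (L := GroupLieAlgebra 𝓘(ℂ, E) G)
      (M := GroupLieAlgebra 𝓘(ℂ, E) G) X Y Y')
    (fun c X Y => lie_smul (R := ℂ) (L := GroupLieAlgebra 𝓘(ℂ, E) G)
      (M := GroupLieAlgebra 𝓘(ℂ, E) G) c X Y)

variable (G) in
/-- The linear Poisson bivector `c` of `𝔤*` at `z`, as a bilinear form on the cotangent space
`(𝔤*)* = 𝔤`: `c_z(X, Y) = z([X, Y])`. -/
def poisson (z : E →L[ℂ] ℂ) : E →ₗ[ℂ] E →ₗ[ℂ] ℂ :=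
  (bracket E G).compr₂ (z : E →ₗ[ℂ] ℂ)

variable (G) in
/-- The map `c_z^♯ : 𝔤 = T_z^*(𝔤*) → T_z(𝔤*) = 𝔤*`, `X ↦ c_z(X, ·)`. -/
def sharp (z : E →L[ℂ] ℂ) : E →ₗ[ℂ] (E →L[ℂ] ℂ) :=
  (LinearMap.toContinuousLinearMap : (E →ₗ[ℂ] ℂ) ≃ₗ[ℂ] (E →L[ℂ] ℂ)).toLinearMap ∘ₗ poisson G z

@[simp] theorem sharp_apply (z : E →L[ℂ] ℂ) (X Y : E) : sharp G z X Y = z (bracket E G X Y) := rfl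

variable (G) in
/-- The characteristic subspace `P_{c,z}` of the bivector `c`, i.e. the tangent space of the
symplectic leaf through `z`. -/
def charSubspace (z : E →L[ℂ] ℂ) : Submodule ℂ (E →L[ℂ] ℂ) := LinearMap.range (sharp G z)

variable (E G) in
/-- `Sing 𝔤*`: the union of the symplectic leaves of nonmaximal dimension of `c`; the dimension of
the leaf through `z` is the rank of `c` at `z`. -/
def Sing : Set (E →L[ℂ] ℂ) :=
  {z | ∃ w : E →L[ℂ] ℂ,
    Module.finrank ℂ (charSubspace G z) < Module.finrank ℂ (charSubspace G w)}

theorem exists_section {A B : Type*} [AddCommGroup A] [Module ℂ A] [AddCommGroup B] [Module ℂ B]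
    (f : A →ₗ[ℂ] B) : ∃ s : B →ₗ[ℂ] A, ∀ a, f (s (f a)) = f a := by
  obtain ⟨s, hs⟩ := f.rangeRestrict.exists_rightInverse_of_surjective f.range_rangeRestrict
  obtain ⟨t, ht⟩ := LinearMap.exists_extend s
  refine ⟨t, fun a => ?_⟩
  have h1 : t (f a) = s (f.rangeRestrict a) := by rw [← ht]; rfl
  rw [h1]
  exact congrArg Subtype.val (LinearMap.congr_fun hs (f.rangeRestrict a))

variable (G) in
theorem exists_sharpSection (z : E →L[ℂ] ℂ) :
    ∃ s : (E →L[ℂ] ℂ) →ₗ[ℂ] E, ∀ X, sharp G z (s (sharp G z X)) = sharp G z X :=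
  exists_section _

variable (G) in
/-- The form `ω_z = (c_z)⁻¹` on the characteristic subspace `P_{c,z}`:
`ω_z(c_z^♯ X, c_z^♯ Y) = c_z(X, Y)`, see `leafForm_sharp`. For convenience it is written as a
bilinear form on all of `𝔤*`, through a linear choice of preimages under `c_z^♯`; only its values
on `P_{c,z}`, which do not depend on the choice, are of interest. -/
def leafForm (z : E →L[ℂ] ℂ) : (E →L[ℂ] ℂ) →ₗ[ℂ] (E →L[ℂ] ℂ) →ₗ[ℂ] ℂ :=
  (poisson G z).compl₁₂ (exists_sharpSection G z).choose (exists_sharpSection G z).choose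

theorem bracket_skew (X Y : E) : bracket E G X Y = -bracket E G Y X := by
  have : CompleteSpace E := FiniteDimensional.complete ℂ E
  have : LieGroup 𝓘(ℂ, E) (minSmoothness ℂ 3) G :=
    LieGroup.of_le (n := ∞) (by
      rw [minSmoothness_of_isRCLikeNormedField]
      exact WithTop.coe_le_coe.2 (le_top : (3 : ℕ∞) ≤ ⊤))
  exact (lie_skew (L := GroupLieAlgebra 𝓘(ℂ, E) G) X Y).symm

theorem leafForm_sharp (z : E →L[ℂ] ℂ) (X Y : E) :
    leafForm G z (sharp G z X) (sharp G z Y) = poisson G z X Y := by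
  have hs := (exists_sharpSection G z).choose_spec
  set s := (exists_sharpSection G z).choose with hsdef
  have h1 : ∀ X Y, poisson G z X Y = sharp G z X Y := fun _ _ => rfl
  have h2 : ∀ X Y, sharp G z X Y = -sharp G z Y X := fun X Y => by
    rw [sharp_apply, sharp_apply, bracket_skew, map_neg]
  change poisson G z (s (sharp G z X)) (s (sharp G z Y)) = _
  rw [h1, hs, h2, hs, ← h2, h1]

variable (G) in
/-- The holomorphic symplectic form `ω = (c|_M)⁻¹` on a complex submanifold `M` of `𝔤*` whose
tangent spaces are the characteristic subspaces of `c`. -/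
def symplecticForm (M : ImmersedSubmanifold ℂ (E →L[ℂ] ℂ)) (x : M.Carrier) :
    M.Model →ₗ[ℂ] M.Model →ₗ[ℂ] ℂ :=
  let d : M.Model →L[ℂ] (E →L[ℂ] ℂ) := mfderiv 𝓘(ℂ, M.Model) 𝓘(ℂ, E →L[ℂ] ℂ) M.incl x
  (leafForm G (M.incl x)).compl₁₂ d.toLinearMap d.toLinearMap

variable (G) in
/-- Holomorphic Casimir functions of `c` over `U`: `c(g) = 0`, i.e.
`c_z(Y, dg_z) = dg_z(c_z^♯ Y) = 0` for all covectors `Y`. -/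
structure IsHolomorphicCasimir (U : Set (E →L[ℂ] ℂ)) (g : (E →L[ℂ] ℂ) → ℂ) : Prop where
  holomorphic : DifferentiableOn ℂ g U
  casimir : ∀ z ∈ U, ∀ Y, fderiv ℂ g z (sharp G z Y) = 0

end Coadjoint

/-! ### The real group `G₀` -/

section RealForm

variable {E₀ : Type*} [NormedAddCommGroup E₀] [NormedSpace ℝ E₀]
  {G₀ : Type*} [TopologicalSpace G₀] [ChartedSpace E₀ G₀] [Group G₀]
  {E : Type u} [NormedAddCommGroup E] [NormedSpace ℂ E]
  {G : Type*} [TopologicalSpace G] [ChartedSpace E G] [Group G]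

variable (E₀ E) in
/-- The differential `𝔤₀ → 𝔤` of `ι : G₀ → G` at the identity. -/
def differentialAtOne (ι : G₀ →* G) : E₀ →L[ℝ] E :=
  mfderiv 𝓘(ℝ, E₀) 𝓘(ℝ, E) ι 1

variable (E₀ E) in
/-- `ι : G₀ → G` is a homomorphism of Lie groups that makes the Lie algebra `𝔤` of `G` the
complexification of the Lie algebra `𝔤₀` of `G₀`: every element of `𝔤` is `X + i Y` for unique
`X, Y` in (the image of) `𝔤₀`. -/
structure IsComplexification (ι : G₀ →* G) : Prop where
  contMDiff : ContMDiff 𝓘(ℝ, E₀) 𝓘(ℝ, E) ∞ ι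
  bijective : Function.Bijective (fun p : E₀ × E₀ =>
    differentialAtOne E₀ E ι p.1 + Complex.I • differentialAtOne E₀ E ι p.2)

variable {ι : G₀ →* G}

/-- The real linear isomorphism `𝔤₀ × 𝔤₀ → 𝔤`, `(X, Y) ↦ X + i Y`. -/
def IsComplexification.equiv (hι : IsComplexification E₀ E ι) : (E₀ × E₀) ≃ₗ[ℝ] E :=
  LinearEquiv.ofBijective
    { toFun := fun p : E₀ × E₀ =>
        differentialAtOne E₀ E ι p.1 + Complex.I • differentialAtOne E₀ E ι p.2
      map_add' := fun p q => by
        simp only [Prod.fst_add, Prod.snd_add, map_add, smul_add]; abel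
      map_smul' := fun r p => by
        simp only [Prod.smul_fst, Prod.smul_snd, map_smul, smul_add, RingHom.id_apply,
          smul_comm Complex.I r] } hι.bijective

theorem IsComplexification.equiv_apply (hι : IsComplexification E₀ E ι) (X Y : E₀) :
    hι.equiv (X, Y) = differentialAtOne E₀ E ι X + Complex.I • differentialAtOne E₀ E ι Y := rfl

/-- The complex conjugation `X + i Y ↦ X - i Y` of `𝔤` with respect to `𝔤₀`. -/
def IsComplexification.conj (hι : IsComplexification E₀ E ι) (Z : E) : E :=
  hι.equiv ((hι.equiv.symm Z).1, -(hι.equiv.symm Z).2)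

theorem IsComplexification.conj_add (hι : IsComplexification E₀ E ι) (Z Z' : E) :
    hι.conj (Z + Z') = hι.conj Z + hι.conj Z' := by
  rw [conj, conj, conj, ← map_add, map_add]
  congr 1
  ext
  · rfl
  · simp [add_comm]

theorem IsComplexification.conj_smul (hι : IsComplexification E₀ E ι) (a : ℂ) (Z : E) :
    hι.conj (a • Z) = (starRingEnd ℂ a) • hι.conj Z := by
  obtain ⟨⟨X, Y⟩, rfl⟩ := hι.equiv.surjective Z
  have key : ∀ (b : ℂ) (X Y : E₀),
      b • hι.equiv (X, Y) = hι.equiv (b.re • X - b.im • Y, b.re • Y + b.im • X) := by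
    intro b X Y
    simp only [equiv_apply, map_sub, map_add, map_smul]
    simp only [← Complex.coe_smul]
    have h1 : b = b.re + b.im * Complex.I := (Complex.re_add_im b).symm
    have h2 : Complex.I * Complex.I = -1 := Complex.I_mul_I
    match_scalars
    · linear_combination h1
    · linear_combination Complex.I * h1 + (b.im : ℂ) * h2
  have hc : ∀ X Y : E₀, hι.conj (hι.equiv (X, Y)) = hι.equiv (X, -Y) := fun X Y => by
    simp [conj]
  rw [key, hc, hc, key]
  congr 1
  ext
  · simp
  · simp [add_comm]

/-- The conjugation of `𝔤*`: `z̄(Z) = conj (z (conj Z))`. -/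
def IsComplexification.conjDual [FiniteDimensional ℂ E] (hι : IsComplexification E₀ E ι)
    (z : E →L[ℂ] ℂ) : E →L[ℂ] ℂ :=
  LinearMap.toContinuousLinearMap
    { toFun := fun Z => starRingEnd ℂ (z (hι.conj Z))
      map_add' := fun Z Z' => by simp [hι.conj_add]
      map_smul' := fun a Z => by simp [hι.conj_smul] }

/-- The function `g̃(z) = ∑ conj (∂g/∂z_i) z_i = conj (∑ (∂g/∂z_i) z̄_i) = conj (dg_z(z̄))`, in the
linear coordinates `z_i` of `𝔤*` given by a basis of `𝔤₀`. -/
def IsComplexification.tilde [FiniteDimensional ℂ E] (hι : IsComplexification E₀ E ι)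
    (g : (E →L[ℂ] ℂ) → ℂ) (z : E →L[ℂ] ℂ) : ℂ :=
  starRingEnd ℂ (fderiv ℂ g z (hι.conjDual z))

end RealForm

end CoadjointCR

end

/-! Orbits as manifolds. An orbit map `f` of a Lie group satisfies `f (x * g) = A g (f x)` with `A
g` linear and invertible, so all its differentials have the same rank `r`. By the constant rank
theorem `f` factors near `1` through a slice parametrized by an open subset of `𝕜 ^ r`. The
translates of this slice are charts of the orbit, with the quotient topology of the group. Since the
dimension of the orbit equals the rank of `f`, the projection is a submersion and the inclusion an
immersion. The argument is the same for `G` over `ℂ` and for `G₀` over `ℝ`.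

Tangent spaces. The derivative of `Ad` at `1` is the Lie bracket (`modelDeriv_Ad`), so the orbit map
of `z` has differential `X ↦ z([X, ·]) = c_z^♯ X` at `1`. By homogeneity the tangent space at `x` is
`c_x^♯ 𝔤` for the complex orbit and `c_x^♯ 𝔤₀` for the real one.

Isotropy. `T^{1,0}` of a real subspace `T` is a copy of `T ∩ iT` (`oneZeroPart_eq_map`). Let `u =
c_z^♯ X` and `iu = c_z^♯ X'` with `X, X'` in `𝔤₀`; then `Z = X' - iX` lies in the stabilizer `ker
c_z^♯`. A second such vector `c_z^♯ Y` gives `W = Y' - iY`. At a regular point the stabilizer is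
commutative (`bracket_eq_zero_of_regular`, the argument of Duflo and Vergne), so `[Z, W] = 0`. As
`𝔤₀` is a subalgebra, conjugation gives `[Z̄, W̄] = 0`. Modulo the stabilizer, `X` is `Z̄/(2i)` and
`Y` is `W̄/(2i)`, whence `ω(c_z^♯ X, c_z^♯ Y) = z([X, Y]) = -z([Z̄, W̄])/4 = 0`. The dimension of `T
∩ iT` is constant because `G₀` acts transitively by complex linear maps.

Invariance of `g̃`. The differential of a Casimir function kills the image of `c^♯`, so `g` composed
with the action of `h` near `1` equals `g` near a given point. Differentiation in the point gives
`dg_{w·h} ∘ Ad*(h) = dg_w`. Since `Ad*(h)` commutes with conjugation for `h` in `G₀`, `g̃(w·h) =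
g̃(w)`. Thus `h ↦ g̃(z·h)` is locally constant, hence constant on connected sets. -/

noncomputable section

namespace CoadjointCR

open Set Filter Topology Function

/-! ### Derivatives between manifolds modelled on vector spaces -/

section ModelDeriv

variable {𝕜 : Type*} [NontriviallyNormedField 𝕜]
  {E₁ M₁ E₂ M₂ E₃ M₃ : Type*}
  [NormedAddCommGroup E₁] [NormedSpace 𝕜 E₁] [TopologicalSpace M₁] [ChartedSpace E₁ M₁]
  [NormedAddCommGroup E₂] [NormedSpace 𝕜 E₂] [TopologicalSpace M₂] [ChartedSpace E₂ M₂]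
  [NormedAddCommGroup E₃] [NormedSpace 𝕜 E₃] [TopologicalSpace M₃] [ChartedSpace E₃ M₃]

variable (𝕜 E₁ E₂) in
/-- The derivative of a map between manifolds, as a map between the model spaces. -/
def modelDeriv (f : M₁ → M₂) (x : M₁) : E₁ →L[𝕜] E₂ := mfderiv 𝓘(𝕜, E₁) 𝓘(𝕜, E₂) f x

theorem modelDeriv_comp {g : M₂ → M₃} {f : M₁ → M₂} (x : M₁)
    (hg : MDifferentiableAt 𝓘(𝕜, E₂) 𝓘(𝕜, E₃) g (f x))
    (hf : MDifferentiableAt 𝓘(𝕜, E₁) 𝓘(𝕜, E₂) f x) :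
    modelDeriv 𝕜 E₁ E₃ (fun y => g (f y)) x =
      (modelDeriv 𝕜 E₂ E₃ g (f x)).comp (modelDeriv 𝕜 E₁ E₂ f x) :=
  mfderiv_comp x hg hf

theorem modelDeriv_id (x : M₁) : modelDeriv 𝕜 E₁ E₁ (fun y => y) x = ContinuousLinearMap.id 𝕜 E₁ :=
  mfderiv_id

theorem modelDeriv_const (x : M₁) (y : M₂) : modelDeriv 𝕜 E₁ E₂ (fun _ : M₁ => y) x = 0 :=
  mfderiv_const

theorem modelDeriv_eq_fderiv (f : E₁ → E₂) (x : E₁) : modelDeriv 𝕜 E₁ E₂ f x = fderiv 𝕜 f x :=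
  mfderiv_eq_fderiv

theorem modelDeriv_clm_comp (L : E₂ →L[𝕜] E₃) {f : M₁ → E₂} {x : M₁}
    (hf : MDifferentiableAt 𝓘(𝕜, E₁) 𝓘(𝕜, E₂) f x) :
    modelDeriv 𝕜 E₁ E₃ (fun y => L (f y)) x = L.comp (modelDeriv 𝕜 E₁ E₂ f x) := by
  rw [modelDeriv_comp x L.differentiableAt.mdifferentiableAt hf, modelDeriv_eq_fderiv, L.fderiv]

theorem modelDeriv_eq_fderiv_chart {f : M₁ → M₂} {x : M₁}
    (hf : MDifferentiableAt 𝓘(𝕜, E₁) 𝓘(𝕜, E₂) f x) :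
    modelDeriv 𝕜 E₁ E₂ f x = fderiv 𝕜 (fun y => extChartAt 𝓘(𝕜, E₂) (f x)
      (f ((extChartAt 𝓘(𝕜, E₁) x).symm y))) (extChartAt 𝓘(𝕜, E₁) x x) := by
  have : modelDeriv 𝕜 E₁ E₂ f x = fderivWithin 𝕜 (writtenInExtChartAt 𝓘(𝕜, E₁) 𝓘(𝕜, E₂) x f)
      (range 𝓘(𝕜, E₁)) (extChartAt 𝓘(𝕜, E₁) x x) := by
    unfold modelDeriv
    exact hf.mfderiv
  rw [this, modelWithCornersSelf_coe, range_id, fderivWithin_univ]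
  rfl

end ModelDeriv

/-! ### Complex maps regarded as real maps -/

section RestrictScalars

variable {E₁ M₁ E₂ M₂ : Type*}
  [NormedAddCommGroup E₁] [NormedSpace ℂ E₁] [TopologicalSpace M₁] [ChartedSpace E₁ M₁]
  [NormedAddCommGroup E₂] [NormedSpace ℂ E₂] [TopologicalSpace M₂] [ChartedSpace E₂ M₂]
  {n : WithTop ℕ∞} {f : M₁ → M₂}

theorem contMDiff_real_of_complex (hf : ContMDiff 𝓘(ℂ, E₁) 𝓘(ℂ, E₂) n f) :
    ContMDiff 𝓘(ℝ, E₁) 𝓘(ℝ, E₂) n f := fun x =>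
  contMDiffAt_iff.2 ⟨(contMDiffAt_iff.1 (hf x)).1,
    (contMDiffAt_iff.1 (hf x)).2.restrict_scalars ℝ⟩

theorem modelDeriv_real_of_complex {x : M₁} (hf : MDifferentiableAt 𝓘(ℂ, E₁) 𝓘(ℂ, E₂) f x) :
    modelDeriv ℝ E₁ E₂ f x = (modelDeriv ℂ E₁ E₂ f x).restrictScalars ℝ := by
  have h2 : HasMFDerivAt 𝓘(ℝ, E₁) 𝓘(ℝ, E₂) f x
      ((modelDeriv ℂ E₁ E₂ f x).restrictScalars ℝ : E₁ →L[ℝ] E₂) :=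
    ⟨hf.hasMFDerivAt.1, HasFDerivWithinAt.restrictScalars ℝ hf.hasMFDerivAt.2⟩
  exact h2.mfderiv

end RestrictScalars

/-! ### Submersions have local sections -/

section Submersion

variable {𝕜 : Type*} [RCLike 𝕜]
  {E₁ M₁ E₂ M₂ : Type*}
  [NormedAddCommGroup E₁] [NormedSpace 𝕜 E₁]
  [TopologicalSpace M₁] [ChartedSpace E₁ M₁] [IsManifold 𝓘(𝕜, E₁) ∞ M₁]
  [NormedAddCommGroup E₂] [NormedSpace 𝕜 E₂] [FiniteDimensional 𝕜 E₂]
  [TopologicalSpace M₂] [ChartedSpace E₂ M₂]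

/-- A smooth map between vector spaces with surjective derivative has a local section. -/
theorem exists_localSection_of_contDiffAt {F : E₁ → E₂} {a : E₁} (hF : ContDiffAt 𝕜 ∞ F a)
    (hs : Surjective (fderiv 𝕜 F a)) :
    ∃ s : E₂ → E₁, s (F a) = a ∧ ContDiffAt 𝕜 ∞ s (F a) ∧ ∀ᶠ y in 𝓝 (F a), F (s y) = y := by
  have : CompleteSpace E₂ := FiniteDimensional.complete 𝕜 E₂
  obtain ⟨R, hR⟩ := (fderiv 𝕜 F a : E₁ →ₗ[𝕜] E₂).exists_rightInverse_of_surjective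
    (LinearMap.range_eq_top.2 hs)
  let R' : E₂ →L[𝕜] E₁ := LinearMap.toContinuousLinearMap R
  have hR' : ∀ w, fderiv 𝕜 F a (R' w) = w := fun w => LinearMap.congr_fun hR w
  -- Restricted to the affine slice through `a` in the direction of a right inverse of the
  -- derivative, `F` has derivative `id`, so the inverse function theorem applies to `F ∘ t`.
  let t : E₂ → E₁ := fun w => a + R' (w - F a)
  have ht : ContDiff 𝕜 ∞ t := by fun_prop
  have hta : t (F a) = a := by simp [t]
  have hF' : ContDiffAt 𝕜 ∞ F (t (F a)) := by rwa [hta]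
  have hK : ContDiffAt 𝕜 ∞ (fun w => F (t w)) (F a) := hF'.comp (F a) ht.contDiffAt
  have hKd : HasFDerivAt (fun w => F (t w)) (ContinuousLinearEquiv.refl 𝕜 E₂ : E₂ →L[𝕜] E₂)
      (F a) := by
    have h1 : HasFDerivAt t R' (F a) := by
      have h0 : HasFDerivAt R' R' (F a - F a) := R'.hasFDerivAt
      exact (HasFDerivAt.comp (f := fun w => w - F a) (F a) h0
        ((hasFDerivAt_id (F a)).sub_const (F a))).const_add a
    have h2 : HasFDerivAt F (fderiv 𝕜 F a) (t (F a)) := by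
      rw [hta]; exact (hF.differentiableAt (by simp)).hasFDerivAt
    convert! h2.comp (F a) h1 using 1
    ext w
    exact (hR' w).symm
  have hFa : F (t (F a)) = F a := by rw [hta]
  let Φ := hK.toOpenPartialHomeomorph _ hKd (by simp)
  have hmem : F a ∈ Φ.source := hK.mem_toOpenPartialHomeomorph_source hKd (by simp)
  have hΦ : Φ (F a) = F a := hFa
  have hmem' : F a ∈ Φ.target := by
    have := Φ.map_source hmem
    rwa [hΦ] at this
  have hsymm : Φ.symm (F a) = F a := by
    have := Φ.left_inv hmem
    rwa [hΦ] at this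
  refine ⟨fun y => t (Φ.symm y), by simp only [hsymm, hta], ?_, ?_⟩
  · have h := Φ.contDiffAt_symm (n := ∞) hmem' (f₀' := ContinuousLinearEquiv.refl 𝕜 E₂)
      (by rw [hsymm]; exact hKd) (by rw [hsymm]; exact hK)
    exact ht.contDiffAt.comp (F a) h
  · filter_upwards [Φ.open_target.mem_nhds hmem'] with y hy
    exact Φ.right_inv hy

theorem exists_localSection {p : M₁ → M₂} (hp : ContMDiff 𝓘(𝕜, E₁) 𝓘(𝕜, E₂) ∞ p) (x : M₁)
    (hs : Surjective (modelDeriv 𝕜 E₁ E₂ p x)) :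
    ∃ s : M₂ → M₁, s (p x) = x ∧ ContMDiffAt 𝓘(𝕜, E₂) 𝓘(𝕜, E₁) ∞ s (p x) ∧
      ∀ᶠ y in 𝓝 (p x), p (s y) = y := by
  set φ := extChartAt 𝓘(𝕜, E₁) x with hφ
  set χ := extChartAt 𝓘(𝕜, E₂) (p x) with hχ
  have hpd := hp.mdifferentiable (by simp) x
  rw [modelDeriv_eq_fderiv_chart hpd] at hs
  have hF : ContDiffAt 𝕜 ∞ (fun y => χ (p (φ.symm y))) (φ x) := by
    have := (contMDiffAt_iff.1 (hp x)).2
    rw [modelWithCornersSelf_coe, range_id, contDiffWithinAt_univ] at this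
    exact this
  have hxs : φ.symm (φ x) = x := extChartAt_to_inv x
  obtain ⟨s, hs1, hs2, hs3⟩ := exists_localSection_of_contDiffAt hF hs
  simp only [hxs] at hs1 hs2 hs3
  have hχc : ContMDiffAt 𝓘(𝕜, E₂) 𝓘(𝕜, E₂) ∞ χ (p x) := contMDiffAt_extChartAt
  have hφx : φ x ∈ φ.target := mem_extChartAt_target x
  have hφc : ContMDiffAt 𝓘(𝕜, E₁) 𝓘(𝕜, E₁) ∞ φ.symm (φ x) :=
    (contMDiffOn_extChartAt_symm x).contMDiffAt (extChartAt_target_mem_nhds x)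
  have hsm : ContMDiffAt 𝓘(𝕜, E₂) 𝓘(𝕜, E₁) ∞ (fun y => φ.symm (s (χ y))) (p x) := by
    have h1 : ContMDiffAt 𝓘(𝕜, E₂) 𝓘(𝕜, E₁) ∞ (fun y => s (χ y)) (p x) :=
      ContMDiffAt.comp (p x) hs2.contMDiffAt hχc
    refine ContMDiffAt.comp (p x) ?_ h1
    rw [hs1]; exact hφc
  have hval : φ.symm (s (χ (p x))) = x := by rw [hs1, hxs]
  refine ⟨fun y => φ.symm (s (χ y)), hval, hsm, ?_⟩
  have hc1 : Tendsto χ (𝓝 (p x)) (𝓝 (χ (p x))) := hχc.continuousAt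
  -- `χ` is injective only on its source, so `p (s y)` has to stay in that source for `y` near `p
  -- x`.
  have hc2 : Tendsto (fun y => p (φ.symm (s (χ y)))) (𝓝 (p x)) (𝓝 (p x)) := by
    have h := hsm.continuousAt.tendsto
    simp only [hval] at h
    exact (hp.continuous.tendsto x).comp h
  filter_upwards [hc1.eventually hs3, hc2.eventually (extChartAt_source_mem_nhds (I := 𝓘(𝕜, E₂)) (p x)),
    extChartAt_source_mem_nhds (I := 𝓘(𝕜, E₂)) (p x)] with y h1 h2 h3
  exact χ.injOn h2 h3 h1

/-- A map out of the target of a surjective submersion is smooth if the composite is. -/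
theorem contMDiff_of_comp_submersion {E₃ M₃ : Type*} [NormedAddCommGroup E₃] [NormedSpace 𝕜 E₃]
    [TopologicalSpace M₃] [ChartedSpace E₃ M₃] {p : M₁ → M₂}
    (hp : ContMDiff 𝓘(𝕜, E₁) 𝓘(𝕜, E₂) ∞ p) (hsurj : Surjective p)
    (hs : ∀ x, Surjective (modelDeriv 𝕜 E₁ E₂ p x)) {j : M₂ → M₃}
    (hj : ContMDiff 𝓘(𝕜, E₁) 𝓘(𝕜, E₃) ∞ (fun x => j (p x))) :
    ContMDiff 𝓘(𝕜, E₂) 𝓘(𝕜, E₃) ∞ j := by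
  intro y
  obtain ⟨x, rfl⟩ := hsurj y
  obtain ⟨s, hs1, hs2, hs3⟩ := exists_localSection hp x (hs x)
  have h := ContMDiffAt.comp (p x) (g := fun x => j (p x)) (f := s) (hj _) hs2
  refine h.congr_of_eventuallyEq ?_
  filter_upwards [hs3] with y hy
  simp [Function.comp_apply, hy]

end Submersion

/-! ### The constant rank theorem -/

section ConstantRank

variable {𝕜 : Type*} [RCLike 𝕜]
  {E V W : Type*} [NormedAddCommGroup E] [NormedSpace 𝕜 E] [FiniteDimensional 𝕜 E]
  [NormedAddCommGroup V] [NormedSpace 𝕜 V]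
  [NormedAddCommGroup W] [NormedSpace 𝕜 W]

/-- The rank of `P ∘ A` is the dimension of `W`, hence at least that of `A`. By rank-nullity the
kernel of `P ∘ A` is no larger than that of `A`, which it contains, so the two agree. -/
theorem ker_comp_eq_of_finrank_le {A : E →L[𝕜] V} {P : V →L[𝕜] W}
    (hs : Surjective (P.comp A)) (hr : Module.finrank 𝕜 (LinearMap.range A.toLinearMap) ≤
      Module.finrank 𝕜 W) {v : E} (hv : P (A v) = 0) : A v = 0 := by
  have h1 := A.toLinearMap.finrank_range_add_finrank_ker
  have h2 := (P.comp A).toLinearMap.finrank_range_add_finrank_ker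
  rw [LinearMap.range_eq_top.2 hs, finrank_top] at h2
  have hle : LinearMap.ker A.toLinearMap ≤ LinearMap.ker (P.comp A).toLinearMap := fun x hx => by
    have hx' : A x = 0 := hx
    change P (A x) = 0
    rw [hx', map_zero]
  have h3 := Submodule.eq_of_le_of_finrank_le hle (by omega)
  have h4 : v ∈ LinearMap.ker (P.comp A).toLinearMap := hv
  rw [← h3] at h4
  exact h4

/-- The constant rank theorem: a map of constant rank factors locally through a slice. -/
theorem exists_slice_of_constant_rank [FiniteDimensional 𝕜 W] {F : E → V} {e : E}
    (hFs : ∀ᶠ x in 𝓝 e, ContDiffAt 𝕜 ∞ F x)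
    (P : V →L[𝕜] W) (hP : Surjective (P.comp (fderiv 𝕜 F e)))
    (hr : ∀ᶠ x in 𝓝 e, Module.finrank 𝕜 (LinearMap.range (fderiv 𝕜 F x).toLinearMap) ≤
      Module.finrank 𝕜 W) :
    ∃ σ : W → E, σ (P (F e)) = e ∧ (∀ᶠ w in 𝓝 (P (F e)), ContDiffAt 𝕜 ∞ σ w) ∧
      (∀ᶠ w in 𝓝 (P (F e)), P (F (σ w)) = w) ∧ ∀ᶠ x in 𝓝 e, F (σ (P (F x))) = F x := by
  have hF : ContDiffAt 𝕜 ∞ F e := hFs.self_of_nhds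
  have : CompleteSpace E := FiniteDimensional.complete 𝕜 E
  have : CompleteSpace W := FiniteDimensional.complete 𝕜 W
  let : NormedSpace ℝ E := NormedSpace.restrictScalars ℝ 𝕜 E
  let : NormedSpace ℝ W := NormedSpace.restrictScalars ℝ 𝕜 W
  set A : E →L[𝕜] W := P.comp (fderiv 𝕜 F e) with hA
  let K : Submodule 𝕜 E := LinearMap.ker A.toLinearMap
  -- A projection `Q` to the kernel of `A` completes `A` to an isomorphism `(A, Q)`. Therefore `Ψ =
  -- (P ∘ F, Q)` is a local coordinate system at `e` in which `P ∘ F` becomes the first projection.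
  obtain ⟨Q₀, hQ₀⟩ := K.subtype.exists_leftInverse_of_injective K.ker_subtype
  let Q : E →L[𝕜] K := LinearMap.toContinuousLinearMap Q₀
  have hQ : ∀ k : K, Q k = k := fun k => LinearMap.congr_fun hQ₀ k
  have hbij : Bijective (A.prod Q) := by
    constructor
    · rw [injective_iff_map_eq_zero]
      intro x hx
      have h1 : A x = 0 := congrArg Prod.fst hx
      have h2 : Q x = 0 := congrArg Prod.snd hx
      have h3 := hQ ⟨x, h1⟩
      rw [h2] at h3
      exact (congrArg Subtype.val h3).symm
    · rintro ⟨w, k⟩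
      obtain ⟨x, hx⟩ := hP w
      have hx' : A x = w := hx
      refine ⟨x + (k - Q x : K), ?_⟩
      have hk : A ((k - Q x : K) : E) = 0 := (k - Q x : K).2
      refine Prod.ext ?_ ?_
      · change A (x + _) = w
        rw [map_add, hk, hx', add_zero]
      · change Q (x + _) = k
        rw [map_add, hQ, add_sub_cancel]
  let Ae : E ≃L[𝕜] W × K := ContinuousLinearEquiv.ofBijective (A.prod Q)
    (LinearMap.ker_eq_bot.2 hbij.1) (LinearMap.range_eq_top.2 hbij.2)
  let Ψ₀ : E → W × K := fun x => (P (F x), Q x)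
  have hΨ₀ : ContDiffAt 𝕜 ∞ Ψ₀ e := (P.contDiff.contDiffAt.comp e hF).prodMk Q.contDiff.contDiffAt
  have hΨ₀d : HasFDerivAt Ψ₀ (Ae : E →L[𝕜] W × K) e :=
    (P.hasFDerivAt.comp e (hF.differentiableAt (by simp)).hasFDerivAt).prodMk Q.hasFDerivAt
  let Ψ := hΨ₀.toOpenPartialHomeomorph _ hΨ₀d (by simp)
  have hes : e ∈ Ψ.source := hΨ₀.mem_toOpenPartialHomeomorph_source hΨ₀d (by simp)
  have hΨ : ∀ x, Ψ x = (P (F x), Q x) := fun _ => rfl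
  have het : Ψ e ∈ Ψ.target := Ψ.map_source hes
  have hsymm : Ψ.symm (Ψ e) = e := Ψ.left_inv hes
  have hsm : ContDiffAt 𝕜 ∞ Ψ.symm (Ψ e) :=
    Ψ.contDiffAt_symm het (by rw [hsymm]; exact hΨ₀d) (by rw [hsymm]; exact hΨ₀)
  have hcs : Tendsto Ψ.symm (𝓝 (Ψ e)) (𝓝 e) := by
    have := hsm.continuousAt.tendsto
    rwa [hsymm] at this
  -- Being `C^∞` at a point provides a neighbourhood for each finite order but no common one.
  -- Smoothness of the inverse at nearby points uses instead `hFs` and the openness of the set of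
  -- invertible derivatives.
  have hsme : ∀ᶠ y in 𝓝 (Ψ e), ContDiffAt 𝕜 ∞ Ψ.symm y := by
    have hfd : ContinuousAt (fderiv 𝕜 Ψ₀) e :=
      (hΨ₀.fderiv_right (m := 0) (by simp)).continuousAt
    have hinv : ∀ᶠ x in 𝓝 e, fderiv 𝕜 Ψ₀ x ∈ range ((↑) : (E ≃L[𝕜] W × K) → E →L[𝕜] W × K) :=
      hfd.eventually (by rw [hΨ₀d.fderiv]; exact ContinuousLinearEquiv.nhds Ae)
    filter_upwards [Ψ.open_target.mem_nhds het, hcs.eventually hFs, hcs.eventually hinv]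
      with y h1 h2 ⟨Ay, hAy⟩
    have h3 : ContDiffAt 𝕜 ∞ Ψ₀ (Ψ.symm y) :=
      (P.contDiff.contDiffAt.comp _ h2).prodMk Q.contDiff.contDiffAt
    refine Ψ.contDiffAt_symm h1 (f₀' := Ay) ?_ h3
    rw [hAy]
    exact (h3.differentiableAt (by simp)).hasFDerivAt
  have hgood : ∀ᶠ y in 𝓝 (Ψ e), y ∈ Ψ.target ∧ DifferentiableAt 𝕜 Ψ.symm y ∧
      DifferentiableAt 𝕜 F (Ψ.symm y) ∧
      Module.finrank 𝕜 (LinearMap.range (fderiv 𝕜 F (Ψ.symm y)).toLinearMap) ≤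
        Module.finrank 𝕜 W := by
    have h1 : ∀ᶠ y in 𝓝 (Ψ e), ContDiffAt 𝕜 1 Ψ.symm y :=
      (hsm.of_le (m := 1) (by exact_mod_cast le_top)).eventually (by simp)
    have h2 : ∀ᶠ x in 𝓝 e, ContDiffAt 𝕜 1 F x :=
      (hF.of_le (m := 1) (by exact_mod_cast le_top)).eventually (by simp)
    filter_upwards [Ψ.open_target.mem_nhds het, h1, hcs.eventually h2, hcs.eventually hr]
      with y h1 h2 h3 h4
    exact ⟨h1, h2.differentiableAt (by simp), h3.differentiableAt (by simp), h4⟩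
  obtain ⟨δ, hδ, hball⟩ := Metric.eventually_nhds_iff_ball.1 hgood
  -- In the coordinates `(w, k)`, `P ∘ F` is `w`, so `P ∘ dF` kills the directions `(0, k)`; by the
  -- bound on the rank, so does `dF`. Hence `F` does not depend on `k` on a ball.
  have hderiv : ∀ y ∈ Metric.ball (Ψ e) δ, ∀ k : K,
      fderiv 𝕜 F (Ψ.symm y) (fderiv 𝕜 Ψ.symm y (0, k)) = 0 := by
    intro y hy k
    obtain ⟨h1, h2, h3, h4⟩ := hball y hy
    have hcomp : HasFDerivAt (fun y => P (F (Ψ.symm y)))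
        (P.comp ((fderiv 𝕜 F (Ψ.symm y)).comp (fderiv 𝕜 Ψ.symm y))) y :=
      P.hasFDerivAt.comp y (h3.hasFDerivAt.comp y h2.hasFDerivAt)
    have hfst : HasFDerivAt (fun y => P (F (Ψ.symm y))) (ContinuousLinearMap.fst 𝕜 W K) y := by
      refine (hasFDerivAt_fst (𝕜 := 𝕜) (E := W) (F := K)).congr_of_eventuallyEq ?_
      filter_upwards [Ψ.open_target.mem_nhds h1] with z hz
      exact congrArg Prod.fst (Ψ.right_inv hz)
    have heq := hcomp.unique hfst
    refine ker_comp_eq_of_finrank_le (P := P) ?_ h4 ?_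
    · intro w
      exact ⟨fderiv 𝕜 Ψ.symm y (w, 0), by
        simpa using congrArg (fun L => L (w, (0 : K))) heq⟩
    · simpa using congrArg (fun L => L ((0 : W), k)) heq
  have hconst : ∀ w k k', (w, k) ∈ Metric.ball (Ψ e) δ → (w, k') ∈ Metric.ball (Ψ e) δ →
      F (Ψ.symm (w, k)) = F (Ψ.symm (w, k')) := by
    intro w k k' hk hk'
    let : NormedSpace ℝ K := NormedSpace.restrictScalars ℝ 𝕜 K
    let : NormedSpace ℝ V := NormedSpace.restrictScalars ℝ 𝕜 V
    have hb : ∀ κ : K, (w, κ) ∈ Metric.ball (Ψ e) δ ↔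
        w ∈ Metric.ball (Ψ e).1 δ ∧ κ ∈ Metric.ball (Ψ e).2 δ := fun κ => by
      rw [← ball_prod_same, mem_prod]
    have hd : ∀ κ ∈ Metric.ball (Ψ e).2 δ,
        HasFDerivWithinAt (fun κ => F (Ψ.symm (w, κ))) (0 : K →L[𝕜] V)
          (Metric.ball (Ψ e).2 δ) κ := by
      intro κ hκ
      have hm : (w, κ) ∈ Metric.ball (Ψ e) δ := (hb κ).2 ⟨((hb k).1 hk).1, hκ⟩
      obtain ⟨h1, h2, h3, h4⟩ := hball _ hm
      have hp : HasFDerivAt (fun κ : K => (w, κ)) (ContinuousLinearMap.inr 𝕜 W K) κ :=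
        hasFDerivAt_prodMk_right w κ
      have := (h3.hasFDerivAt.comp (w, κ) h2.hasFDerivAt).comp κ hp
      have hz : ((fderiv 𝕜 F (Ψ.symm (w, κ))).comp (fderiv 𝕜 Ψ.symm (w, κ))).comp
          (ContinuousLinearMap.inr 𝕜 W K) = 0 :=
        ContinuousLinearMap.ext fun κ' => hderiv _ hm κ'
      rw [hz] at this
      exact this.hasFDerivWithinAt
    exact (convex_ball (Ψ e).2 δ).is_const_of_fderivWithin_eq_zero (𝕜 := 𝕜)
      (fun κ hκ => (hd κ hκ).differentiableWithinAt)
      (fun κ hκ => (hd κ hκ).fderivWithin (Metric.isOpen_ball.uniqueDiffWithinAt hκ))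
      ((hb k).1 hk).2 ((hb k').1 hk').2
  have hpair : Tendsto (fun w => (w, Q e)) (𝓝 (P (F e))) (𝓝 (Ψ e)) :=
    (Continuous.prodMk_left (Q e)).tendsto _
  have hσe : Ψ.symm (P (F e), Q e) = e := hsymm
  refine ⟨fun w => Ψ.symm (w, Q e), hσe, ?_, ?_, ?_⟩
  · filter_upwards [hpair.eventually hsme] with w hw
    have : ContDiffAt 𝕜 ∞ (fun w : W => (w, Q e)) w :=
      contDiffAt_id.prodMk contDiffAt_const
    exact ContDiffAt.comp w (g := Ψ.symm) hw this
  · filter_upwards [hpair.eventually (Ψ.open_target.mem_nhds het)] with w hw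
    exact congrArg Prod.fst (Ψ.right_inv hw)
  · have hc : Tendsto Ψ (𝓝 e) (𝓝 (Ψ e)) := Ψ.continuousAt hes
    have hcF : Tendsto (fun x => P (F x)) (𝓝 e) (𝓝 (P (F e))) :=
      (P.continuous.continuousAt.comp hF.continuousAt)
    filter_upwards [hc.eventually (Metric.ball_mem_nhds _ hδ), Ψ.open_source.mem_nhds hes,
      (hpair.comp hcF).eventually (Metric.ball_mem_nhds _ hδ)] with x h1 h2 h3
    have h4 := hconst (P (F x)) (Q e) (Q x) h3 h1
    rw [h4]
    exact congrArg F (Ψ.left_inv h2)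

end ConstantRank

/-! ### Orbits of Lie groups as immersed submanifolds -/

section Orbit

variable {𝕜 : Type} [RCLike 𝕜] {E : Type*} [NormedAddCommGroup E] [NormedSpace 𝕜 E]
  {H : Type*} [TopologicalSpace H] [ChartedSpace E H] [Group H]
  {V : Type u} [NormedAddCommGroup V] [NormedSpace 𝕜 V]

variable (E) in
/-- `f` is a smooth map that is equivariant for the right multiplication of `H` and a linear right
action `A` on `V`. -/
structure IsOrbitMap (A : H → V →L[𝕜] V) (f : H → V) : Prop where
  contMDiff : ContMDiff 𝓘(𝕜, E) 𝓘(𝕜, V) ∞ f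
  map_mul : ∀ x g, f (x * g) = A g (f x)
  act_inv : ∀ g v, A g (A g⁻¹ v) = v

theorem IsOrbitMap.inv_act {A : H → V →L[𝕜] V} {f : H → V} (hf : IsOrbitMap E A f) (g : H) (v : V) :
    A g⁻¹ (A g v) = v := by
  simpa using hf.act_inv g⁻¹ v

variable [LieGroup 𝓘(𝕜, E) ∞ H]

theorem surjective_modelDeriv_mul_left (g x : H) :
    Surjective (modelDeriv 𝕜 E E (fun y => g * y) x) := by
  have hl : ∀ k : H, MDifferentiable 𝓘(𝕜, E) 𝓘(𝕜, E) (fun y : H => k * y) := fun k =>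
    (contMDiff_mul_left (n := ∞)).mdifferentiable (by simp)
  have hid : (fun y : H => g * (g⁻¹ * y)) = fun y => y := by ext; simp
  have h := modelDeriv_comp (g := fun y => g * y) (f := fun y => g⁻¹ * y) (g * x) (hl g _) (hl g⁻¹ _)
  rw [hid, modelDeriv_id, inv_mul_cancel_left] at h
  intro v
  exact ⟨_, (DFunLike.congr_fun h v).symm⟩

theorem surjective_modelDeriv_mul_right (g x : H) :
    Surjective (modelDeriv 𝕜 E E (fun y => y * g) x) := by
  have hl : ∀ k : H, MDifferentiable 𝓘(𝕜, E) 𝓘(𝕜, E) (fun y : H => y * k) := fun k =>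
    (contMDiff_mul_right (n := ∞)).mdifferentiable (by simp)
  have hid : (fun y : H => y * g⁻¹ * g) = fun y => y := by ext; simp
  have h := modelDeriv_comp (g := fun y => y * g) (f := fun y => y * g⁻¹) (x * g) (hl g _)
    (hl g⁻¹ _)
  rw [hid, modelDeriv_id, mul_inv_cancel_right] at h
  intro v
  exact ⟨_, (DFunLike.congr_fun h v).symm⟩

/-- Differentiate `f (x * h) = A h (f x)` at `x = 1`; right multiplication by `h` has surjective
differential. -/
theorem IsOrbitMap.range_modelDeriv {A : H → V →L[𝕜] V} {f : H → V}
    (hf : IsOrbitMap E A f) (h : H) :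
    LinearMap.range (modelDeriv 𝕜 E V f h).toLinearMap =
      (LinearMap.range (modelDeriv 𝕜 E V f 1).toLinearMap).map (A h).toLinearMap := by
  have hm := hf.contMDiff.mdifferentiable (by simp)
  have h1 : modelDeriv 𝕜 E V (fun x => f (x * h)) 1 =
      (modelDeriv 𝕜 E V f (1 * h)).comp (modelDeriv 𝕜 E E (fun y => y * h) 1) :=
    modelDeriv_comp 1 (hm _) ((contMDiff_mul_right (n := ∞)).mdifferentiable (by simp) _)
  have h2 : (fun x => f (x * h)) = fun x => A h (f x) := funext fun x => hf.map_mul x h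
  rw [h2, modelDeriv_clm_comp _ (hm 1), one_mul] at h1
  ext v
  constructor
  · rintro ⟨u, rfl⟩
    obtain ⟨w, rfl⟩ := surjective_modelDeriv_mul_right (𝕜 := 𝕜) (E := E) h 1 u
    exact ⟨_, ⟨w, rfl⟩, DFunLike.congr_fun h1 w⟩
  · rintro ⟨_, ⟨w, rfl⟩, rfl⟩
    exact ⟨_, (DFunLike.congr_fun h1 w).symm⟩

theorem IsOrbitMap.finrank_range_modelDeriv {A : H → V →L[𝕜] V} {f : H → V}
    (hf : IsOrbitMap E A f) (h : H) :
    Module.finrank 𝕜 (LinearMap.range (modelDeriv 𝕜 E V f h).toLinearMap) =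
      Module.finrank 𝕜 (LinearMap.range (modelDeriv 𝕜 E V f 1).toLinearMap) := by
  rw [hf.range_modelDeriv h]
  exact (Submodule.equivMapOfInjective _ (LeftInverse.injective (hf.inv_act h)) _).symm.finrank_eq

/-- A local slice, parametrized by an open subset of `𝕜 ^ r`, for an orbit map. -/
structure OrbitSlice (E : Type*) [NormedAddCommGroup E] [NormedSpace 𝕜 E] {H : Type*}
    [TopologicalSpace H] [ChartedSpace E H] [Group H] (f : H → V) (r : ℕ) where
  /-- the coordinates -/
  coord : V →L[𝕜] (Fin r → 𝕜)
  /-- the domain of the parametrization -/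
  base : Set (Fin r → 𝕜)
  /-- the parametrization -/
  param : (Fin r → 𝕜) → H
  /-- a neighbourhood of `1` in which every point is equivalent to one in the slice -/
  nhd : Set H
  isOpen_base : IsOpen base
  isOpen_nhd : IsOpen nhd
  one_mem : 1 ∈ nhd
  contMDiffOn_param : ContMDiffOn 𝓘(𝕜, Fin r → 𝕜) 𝓘(𝕜, E) ∞ param base
  param_mem : ∀ w ∈ base, param w ∈ nhd
  coord_mem : ∀ x ∈ nhd, coord (f x) ∈ base
  coord_param : ∀ w ∈ base, coord (f (param w)) = w
  param_coord : ∀ x ∈ nhd, f (param (coord (f x))) = f x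

/-- By equivariance the orbit map has constant rank, so the constant rank theorem applies to it in
the chart at `1`. The coordinates come from a linear projection to the range of the differential at
`1`. -/
theorem IsOrbitMap.nonempty_slice [FiniteDimensional 𝕜 E] [FiniteDimensional 𝕜 V]
    {A : H → V →L[𝕜] V} {f : H → V} (hf : IsOrbitMap E A f) :
    Nonempty (OrbitSlice (𝕜 := 𝕜) E f
      (Module.finrank 𝕜 (LinearMap.range (modelDeriv 𝕜 E V f 1).toLinearMap))) := by
  have hm := hf.contMDiff.mdifferentiable (by simp)
  set R := LinearMap.range (modelDeriv 𝕜 E V f 1).toLinearMap with hR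
  set r := Module.finrank 𝕜 R with hr
  obtain ⟨p, hp⟩ := R.subtype.exists_leftInverse_of_injective R.ker_subtype
  let b : R ≃ₗ[𝕜] (Fin r → 𝕜) := LinearEquiv.ofFinrankEq _ _ (by simp [hr])
  let P : V →L[𝕜] (Fin r → 𝕜) := LinearMap.toContinuousLinearMap (b.toLinearMap ∘ₗ p)
  have hPs : Surjective (P.comp (modelDeriv 𝕜 E V f 1)) := by
    intro w
    obtain ⟨x, hx⟩ := (b.symm w).2
    refine ⟨x, ?_⟩
    change b (p (modelDeriv 𝕜 E V f 1 x)) = w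
    have h1 : p (b.symm w : R) = b.symm w := LinearMap.congr_fun hp _
    have h2 : modelDeriv 𝕜 E V f 1 x = (b.symm w : R) := hx
    rw [h2, h1, b.apply_symm_apply]
  set φ := extChartAt 𝓘(𝕜, E) (1 : H) with hφ
  have hφ1 : φ.symm (φ 1) = 1 := extChartAt_to_inv 1
  have hφc : ∀ x ∈ φ.target, ContMDiffAt 𝓘(𝕜, E) 𝓘(𝕜, E) ∞ φ.symm x := fun x hx =>
    (contMDiffOn_extChartAt_symm (1 : H)).contMDiffAt ((isOpen_extChartAt_target 1).mem_nhds hx)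
  have hF : ∀ᶠ x in 𝓝 (φ 1), ContDiffAt 𝕜 ∞ (fun y => f (φ.symm y)) x := by
    filter_upwards [(isOpen_extChartAt_target (I := 𝓘(𝕜, E)) (1 : H)).mem_nhds
      (mem_extChartAt_target 1)] with x hx
    exact contMDiffAt_iff_contDiffAt.1 (ContMDiffAt.comp x (hf.contMDiff _) (hφc _ hx))
  have hFd : fderiv 𝕜 (fun y => f (φ.symm y)) (φ 1) = modelDeriv 𝕜 E V f 1 := by
    rw [modelDeriv_eq_fderiv_chart (hm 1)]
    rfl
  obtain ⟨σ, hσ1, hσ2, hσ3, hσ4⟩ := exists_slice_of_constant_rank hF P (by rwa [hFd]) (by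
    filter_upwards [(isOpen_extChartAt_target (I := 𝓘(𝕜, E)) (1 : H)).mem_nhds
      (mem_extChartAt_target 1)] with x hx
    -- Composition with the chart cannot raise the rank, and only this upper bound is needed.
    have h1 := modelDeriv_comp (g := f) (f := φ.symm) x (hm _)
      ((hφc x hx).mdifferentiableAt (by simp))
    rw [modelDeriv_eq_fderiv] at h1
    rw [h1, Module.finrank_fin_fun, hr, hR, ← hf.finrank_range_modelDeriv (φ.symm x)]
    exact Submodule.finrank_mono (LinearMap.range_comp_le_range _ _))
  rw [hφ1] at hσ1 hσ2 hσ3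
  have hφcont : ContinuousAt φ 1 := continuousAt_extChartAt 1
  have hnhd : ∀ᶠ x in 𝓝 (1 : H), f (φ.symm (σ (P (f x)))) = f x := by
    filter_upwards [hφcont.eventually hσ4, extChartAt_source_mem_nhds (I := 𝓘(𝕜, E)) (1 : H)]
      with x h1 h2
    rwa [φ.left_inv h2] at h1
  obtain ⟨N, hN, hNo, hN1⟩ := eventually_nhds_iff.1 hnhd
  have hp1 : φ.symm (σ (P (f 1))) = 1 := by rw [hσ1, hφ1]
  have hsm : ∀ᶠ w in 𝓝 (P (f 1)), ContMDiffAt 𝓘(𝕜, Fin r → 𝕜) 𝓘(𝕜, E) ∞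
      (fun w => φ.symm (σ w)) w := by
    have hσc := hσ2.self_of_nhds.continuousAt.tendsto
    rw [hσ1] at hσc
    filter_upwards [hσ2, hσc.eventually ((isOpen_extChartAt_target (1 : H)).mem_nhds
      (mem_extChartAt_target 1))] with w h1 h2
    exact ContMDiffAt.comp w (g := φ.symm) (hφc _ h2) h1.contMDiffAt
  have hmemN : ∀ᶠ w in 𝓝 (P (f 1)), φ.symm (σ w) ∈ N := by
    have := hsm.self_of_nhds.continuousAt.tendsto
    rw [hp1] at this
    exact this.eventually (hNo.mem_nhds hN1)
  obtain ⟨B, hB, hBo, hB1⟩ := eventually_nhds_iff.1 ((hsm.and hmemN).and hσ3)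
  have hPf : Continuous fun x => P (f x) := P.continuous.comp hf.contMDiff.continuous
  exact ⟨{
    coord := P
    base := B
    param := fun w => φ.symm (σ w)
    nhd := N ∩ (fun x => P (f x)) ⁻¹' B
    isOpen_base := hBo
    isOpen_nhd := hNo.inter (hBo.preimage hPf)
    one_mem := ⟨hN1, hB1⟩
    contMDiffOn_param := fun w hw => (hB w hw).1.1.contMDiffWithinAt
    param_mem := fun w hw => ⟨(hB w hw).1.2, by
      have : P (f (φ.symm (σ w))) = w := (hB w hw).2
      rwa [mem_preimage, this]⟩
    coord_mem := fun x hx => hx.2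
    coord_param := fun w hw => (hB w hw).2
    param_coord := fun x hx => hN x hx.1 }⟩

end Orbit

/-! ### The atlas of an orbit -/

section OrbitManifold

section

variable {H : Type*} {V : Type u}

/-- The orbit, as a type with the quotient topology of the group. -/
def OrbitSpace (f : H → V) : Type u := Set.range f

/-- The projection of the group to the orbit. -/
def OrbitSpace.proj (f : H → V) : H → OrbitSpace f := Set.rangeFactorization f

/-- The inclusion of the orbit into the vector space. -/
def OrbitSpace.incl (f : H → V) : OrbitSpace f → V := Subtype.val

instance [TopologicalSpace H] (f : H → V) : TopologicalSpace (OrbitSpace f) :=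
  TopologicalSpace.coinduced (OrbitSpace.proj f) inferInstance

theorem OrbitSpace.continuous_proj [TopologicalSpace H] (f : H → V) : Continuous (OrbitSpace.proj f) :=
  continuous_coinduced_rng

theorem OrbitSpace.surjective_proj (f : H → V) : Surjective (OrbitSpace.proj f) :=
  rangeFactorization_surjective

theorem OrbitSpace.incl_proj (f : H → V) (h : H) :
    OrbitSpace.incl f (OrbitSpace.proj f h) = f h := rfl

theorem OrbitSpace.incl_injective (f : H → V) : Injective (OrbitSpace.incl f) :=
  Subtype.val_injective

end

variable {𝕜 : Type} [RCLike 𝕜] {E : Type*} [NormedAddCommGroup E] [NormedSpace 𝕜 E]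
  {H : Type*} [TopologicalSpace H] [ChartedSpace E H] [Group H]
  {V : Type u} [NormedAddCommGroup V] [NormedSpace 𝕜 V]

variable [LieGroup 𝓘(𝕜, E) ∞ H] {A : H → V →L[𝕜] V} {f : H → V} {r : ℕ}

/-- If `x` has the same image as the slice point `s`, then `x * s⁻¹` fixes `f 1`, and left
translation by it does not change `f`. It carries the neighbourhood `S.nhd` of `s` to a
neighbourhood of `x` inside the set. This makes the chart domains open in the quotient topology. -/
theorem OrbitSlice.isOpen_saturation (hf : IsOrbitMap E A f) (S : OrbitSlice (𝕜 := 𝕜) E f r) :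
    IsOpen {x : H | S.coord (f x) ∈ S.base ∧ f (S.param (S.coord (f x))) = f x} := by
  have : ContinuousMul H := continuousMul_of_contMDiffMul 𝓘(𝕜, E) ∞
  rw [isOpen_iff_mem_nhds]
  rintro x ⟨hx1, hx2⟩
  set s := S.param (S.coord (f x)) with hs
  have hk : f (x * s⁻¹) = f 1 := by
    rw [hf.map_mul, ← hx2, ← hf.map_mul, mul_inv_cancel]
  have hkx : ∀ y, f (x * s⁻¹ * y) = f y := fun y => by
    rw [hf.map_mul, hk, ← hf.map_mul, one_mul]
  have hc : Continuous fun y : H => (x * s⁻¹)⁻¹ * y := continuous_const.mul continuous_id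
  have hmem : (x * s⁻¹)⁻¹ * x ∈ S.nhd := by
    have : (x * s⁻¹)⁻¹ * x = s := by group
    rw [this]
    exact S.param_mem _ hx1
  filter_upwards [(S.isOpen_nhd.preimage hc).mem_nhds hmem] with y hy
  have h1 := hkx ((x * s⁻¹)⁻¹ * y)
  rw [mul_inv_cancel_left] at h1
  change S.coord (f y) ∈ S.base ∧ f (S.param (S.coord (f y))) = f y
  rw [h1]
  exact ⟨S.coord_mem _ hy, S.param_coord _ hy⟩

/-- The chart of the orbit given by the translate of a slice. -/
def OrbitSlice.chart (hf : IsOrbitMap E A f) (S : OrbitSlice (𝕜 := 𝕜) E f r) (g : H) :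
    OpenPartialHomeomorph (OrbitSpace f) (Fin r → 𝕜) where
  toFun y := S.coord (A g⁻¹ (OrbitSpace.incl f y))
  invFun w := OrbitSpace.proj f (S.param w * g)
  source := {y | S.coord (A g⁻¹ (OrbitSpace.incl f y)) ∈ S.base ∧
    f (S.param (S.coord (A g⁻¹ (OrbitSpace.incl f y)))) = A g⁻¹ (OrbitSpace.incl f y)}
  target := S.base
  map_source' y hy := hy.1
  map_target' w hw := by
    simp only [mem_ofPred_eq, OrbitSpace.incl_proj, hf.map_mul, hf.inv_act, S.coord_param w hw, hw,
      and_self]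
  left_inv' y hy := OrbitSpace.incl_injective f (by
    rw [OrbitSpace.incl_proj, hf.map_mul, hy.2, hf.act_inv])
  right_inv' w hw := by
    simp only [OrbitSpace.incl_proj, hf.map_mul, hf.inv_act, S.coord_param w hw]
  open_source := by
    have : ContinuousMul H := continuousMul_of_contMDiffMul 𝓘(𝕜, E) ∞
    rw [isOpen_coinduced]
    have hc : Continuous fun y : H => y * g⁻¹ := continuous_id.mul continuous_const
    have := (S.isOpen_saturation hf).preimage hc
    simpa only [preimage_ofPred_eq, hf.map_mul] using! this
  open_target := S.isOpen_base
  continuousOn_toFun := by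
    refine Continuous.continuousOn (continuous_coinduced_dom.2 ?_)
    exact S.coord.continuous.comp ((A g⁻¹).continuous.comp hf.contMDiff.continuous)
  continuousOn_invFun := by
    have : ContinuousMul H := continuousMul_of_contMDiffMul 𝓘(𝕜, E) ∞
    exact (OrbitSpace.continuous_proj f).comp_continuousOn
      (S.contMDiffOn_param.continuousOn.mul continuousOn_const)

theorem OrbitSlice.proj_mem_chart_source (hf : IsOrbitMap E A f)
    (S : OrbitSlice (𝕜 := 𝕜) E f r) (g : H) : OrbitSpace.proj f g ∈ (S.chart hf g).source := by
  change S.coord (A g⁻¹ (f g)) ∈ S.base ∧ f (S.param (S.coord (A g⁻¹ (f g)))) = A g⁻¹ (f g)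
  rw [← hf.map_mul, mul_inv_cancel]
  exact ⟨S.coord_mem 1 S.one_mem, S.param_coord 1 S.one_mem⟩

/-- The atlas of the orbit. -/
@[reducible] def OrbitSlice.chartedSpace (hf : IsOrbitMap E A f)
    (S : OrbitSlice (𝕜 := 𝕜) E f r) : ChartedSpace (Fin r → 𝕜) (OrbitSpace f) where
  atlas := range (S.chart hf)
  chartAt y := S.chart hf (surjInv (OrbitSpace.surjective_proj f) y)
  mem_chart_source y := by
    have := S.proj_mem_chart_source hf (surjInv (OrbitSpace.surjective_proj f) y)
    rwa [surjInv_eq (OrbitSpace.surjective_proj f)] at this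
  chart_mem_atlas y := mem_range_self _

theorem OrbitSlice.contMDiffOn_param_mul (S : OrbitSlice (𝕜 := 𝕜) E f r) (g : H) :
    ContMDiffOn 𝓘(𝕜, Fin r → 𝕜) 𝓘(𝕜, E) ∞ (fun w => S.param w * g) S.base :=
  (contMDiff_mul_right (a := g)).comp_contMDiffOn S.contMDiffOn_param

/-- A coordinate change lifts to the group: it is `w ↦ S.coord (A g'⁻¹ (f (S.param w * g)))`, a
composite of smooth maps. -/
theorem OrbitSlice.isManifold (hf : IsOrbitMap E A f) (S : OrbitSlice (𝕜 := 𝕜) E f r) :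
    letI := S.chartedSpace hf
    IsManifold 𝓘(𝕜, Fin r → 𝕜) ∞ (OrbitSpace f) := by
  let := S.chartedSpace hf
  refine isManifold_of_contDiffOn _ _ _ ?_
  rintro _ _ ⟨g, rfl⟩ ⟨g', rfl⟩
  simp only [modelWithCornersSelf_coe, modelWithCornersSelf_coe_symm, Function.comp_id,
    Function.id_comp, preimage_id, range_id, inter_univ]
  have h1 : ContMDiffOn 𝓘(𝕜, Fin r → 𝕜) 𝓘(𝕜, Fin r → 𝕜) ∞
      (fun w => S.coord (A g'⁻¹ (f (S.param w * g)))) S.base :=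
    (S.coord.contMDiff.comp ((A g'⁻¹).contMDiff.comp hf.contMDiff)).comp_contMDiffOn
      (S.contMDiffOn_param_mul g)
  refine (contMDiffOn_iff_contDiffOn.1 h1).mono ?_
  intro w hw
  exact hw.1

theorem OrbitSlice.contMDiff_proj (hf : IsOrbitMap E A f) (S : OrbitSlice (𝕜 := 𝕜) E f r) :
    letI := S.chartedSpace hf
    ContMDiff 𝓘(𝕜, E) 𝓘(𝕜, Fin r → 𝕜) ∞ (OrbitSpace.proj f) := by
  let := S.chartedSpace hf
  have := S.isManifold hf
  refine contMDiff_iff_target.2 ⟨OrbitSpace.continuous_proj f, fun y => ?_⟩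
  have h1 : ContMDiff 𝓘(𝕜, E) 𝓘(𝕜, Fin r → 𝕜) ∞
      (fun h => S.coord (A (surjInv (OrbitSpace.surjective_proj f) y)⁻¹ (f h))) :=
    S.coord.contMDiff.comp ((A _).contMDiff.comp hf.contMDiff)
  exact h1.contMDiffOn

theorem OrbitSlice.contMDiff_incl (hf : IsOrbitMap E A f) (S : OrbitSlice (𝕜 := 𝕜) E f r) :
    letI := S.chartedSpace hf
    ContMDiff 𝓘(𝕜, Fin r → 𝕜) 𝓘(𝕜, V) ∞ (OrbitSpace.incl f) := by
  let := S.chartedSpace hf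
  have := S.isManifold hf
  intro y
  set g := surjInv (OrbitSpace.surjective_proj f) y with hg
  have hs : y ∈ (S.chart hf g).source := mem_chart_source (Fin r → 𝕜) y
  have h1 : ContMDiffOn 𝓘(𝕜, Fin r → 𝕜) 𝓘(𝕜, V) ∞ (fun w => f (S.param w * g)) S.base :=
    hf.contMDiff.comp_contMDiffOn (S.contMDiffOn_param_mul g)
  have h2 : ContMDiffAt 𝓘(𝕜, Fin r → 𝕜) 𝓘(𝕜, Fin r → 𝕜) ∞ (S.chart hf g) y :=
    contMDiffAt_extChartAt (I := 𝓘(𝕜, Fin r → 𝕜)) (x := y)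
  have h3 := ContMDiffAt.comp y
    (h1.contMDiffAt (S.isOpen_base.mem_nhds ((S.chart hf g).map_source hs))) h2
  refine h3.congr_of_eventuallyEq ?_
  filter_upwards [(S.chart hf g).open_source.mem_nhds hs] with z hz
  exact congrArg (OrbitSpace.incl f) ((S.chart hf g).left_inv hz).symm

/-- The rank of `b ∘ a` is at most the ranks of `a` and of `b`, and these are at most the dimension
of `K₂`; equality at the ends forces it throughout. Applied to the factorization of an orbit map,
this gives the immersion and the submersion together. -/
theorem injective_and_surjective_of_comp {R K₁ K₂ K₃ : Type*} [Field R]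
    [AddCommGroup K₁] [Module R K₁] [AddCommGroup K₂] [Module R K₂] [AddCommGroup K₃]
    [Module R K₃] [FiniteDimensional R K₂] (a : K₁ →ₗ[R] K₂) (b : K₂ →ₗ[R] K₃)
    (h : Module.finrank R (LinearMap.range (b ∘ₗ a)) = Module.finrank R K₂) :
    Injective b ∧ Surjective a := by
  have h1 : Module.finrank R (LinearMap.range (b ∘ₗ a)) ≤ Module.finrank R (LinearMap.range b) :=
    Submodule.finrank_mono (LinearMap.range_comp_le_range _ _)
  have h2 := b.finrank_range_add_finrank_ker
  have h3 : Module.finrank R (LinearMap.range (b ∘ₗ a)) ≤ Module.finrank R (LinearMap.range a) := by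
    rw [LinearMap.range_comp]
    exact Submodule.finrank_map_le _ _
  constructor
  · rw [← LinearMap.ker_eq_bot, ← Submodule.finrank_eq_zero (R := R)]
    omega
  · rw [← LinearMap.range_eq_top]
    exact Submodule.eq_top_of_finrank_eq (le_antisymm (Submodule.finrank_le _) (h ▸ h3))

/-- The orbit of an orbit map is an immersed submanifold. -/
theorem IsOrbitMap.exists_immersedSubmanifold [FiniteDimensional 𝕜 E] [FiniteDimensional 𝕜 V]
    (hf : IsOrbitMap E A f) : ∃ M : ImmersedSubmanifold 𝕜 V, M.IsOrbit E f := by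
  obtain ⟨S⟩ := hf.nonempty_slice
  set r := Module.finrank 𝕜 (LinearMap.range (modelDeriv 𝕜 E V f 1).toLinearMap) with hr
  let := S.chartedSpace hf
  have := S.isManifold hf
  have hi := S.contMDiff_incl hf
  have hp := S.contMDiff_proj hf
  have key : ∀ h : H, Injective (modelDeriv 𝕜 (Fin r → 𝕜) V (OrbitSpace.incl f)
        (OrbitSpace.proj f h)) ∧
      Surjective (modelDeriv 𝕜 E (Fin r → 𝕜) (OrbitSpace.proj f) h) := by
    intro h
    have h1 : modelDeriv 𝕜 E V f h = (modelDeriv 𝕜 (Fin r → 𝕜) V (OrbitSpace.incl f)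
        (OrbitSpace.proj f h)).comp (modelDeriv 𝕜 E (Fin r → 𝕜) (OrbitSpace.proj f) h) :=
      modelDeriv_comp h (hi.mdifferentiable (by simp) _) (hp.mdifferentiable (by simp) _)
    refine injective_and_surjective_of_comp (R := 𝕜)
      (modelDeriv 𝕜 E (Fin r → 𝕜) (OrbitSpace.proj f) h).toLinearMap
      (modelDeriv 𝕜 (Fin r → 𝕜) V (OrbitSpace.incl f) (OrbitSpace.proj f h)).toLinearMap ?_
    have h2 := hf.finrank_range_modelDeriv h
    rw [h1] at h2
    rw [Module.finrank_fin_fun]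
    exact h2
  refine ⟨{
    Model := Fin r → 𝕜
    Carrier := OrbitSpace f
    incl := OrbitSpace.incl f
    incl_injective := OrbitSpace.incl_injective f
    incl_contMDiff := hi
    incl_immersion := fun y => ?_ }, OrbitSpace.proj f, OrbitSpace.surjective_proj f, hp,
    fun h => (key h).2, OrbitSpace.incl_proj f⟩
  obtain ⟨h, rfl⟩ := OrbitSpace.surjective_proj f y
  exact (key h).1

end OrbitManifold

/-! ### The adjoint and coadjoint representations -/

section Adjoint

variable {E : Type u} [NormedAddCommGroup E] [NormedSpace ℂ E]
  {G : Type*} [TopologicalSpace G] [ChartedSpace E G] [Group G]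

theorem Ad_eq (g : G) : Ad g = modelDeriv ℂ E E (fun x : G => g * x * g⁻¹) 1 := rfl

variable (E) in
/-- The coadjoint action as a continuous linear map. -/
def coadjL (g : G) : (E →L[ℂ] ℂ) →L[ℂ] (E →L[ℂ] ℂ) :=
  (ContinuousLinearMap.compL ℂ E E ℂ).flip (Ad g)

theorem coadjL_apply (g : G) (z : E →L[ℂ] ℂ) : coadjL E g z = coadj g z := rfl

theorem coadj_apply (g : G) (z : E →L[ℂ] ℂ) (X : E) : coadj g z X = z (Ad g X) := rfl

theorem Ad_one : Ad (E := E) (1 : G) = ContinuousLinearMap.id ℂ E := by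
  rw [Ad_eq]
  simp only [one_mul, inv_one, mul_one]
  exact modelDeriv_id _

theorem coadj_one (z : E →L[ℂ] ℂ) : coadj (1 : G) z = z := by
  ext X
  simp [coadj_apply, Ad_one]

variable [LieGroup 𝓘(ℂ, E) ∞ G]

theorem contMDiff_conj (g : G) :
    ContMDiff 𝓘(ℂ, E) 𝓘(ℂ, E) ∞ (fun x : G => g * x * g⁻¹) :=
  contMDiff_mul_right.comp contMDiff_mul_left

theorem mdifferentiable_conj (g : G) :
    MDifferentiable 𝓘(ℂ, E) 𝓘(ℂ, E) (fun x : G => g * x * g⁻¹) :=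
  (contMDiff_conj g).mdifferentiable (by simp)

theorem Ad_mul (g h : G) : Ad (E := E) (g * h) = (Ad g).comp (Ad h) := by
  have h1 := modelDeriv_comp (1 : G) (mdifferentiable_conj (E := E) g (h * 1 * h⁻¹))
    (mdifferentiable_conj (E := E) h 1)
  rw [mul_one, mul_inv_cancel] at h1
  rw [Ad_eq, Ad_eq, Ad_eq, ← h1]
  congr 1
  ext x
  group

/-- `Ad g` is the partial derivative at `x = 1` of the map `(g, x) ↦ g * x * g⁻¹`, smooth in both
variables. -/
theorem contMDiff_Ad : ContMDiff 𝓘(ℂ, E) 𝓘(ℂ, E →L[ℂ] E) ∞ (Ad : G → E →L[ℂ] E) := by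
  intro g₀
  have hc : ContMDiff (𝓘(ℂ, E).prod 𝓘(ℂ, E)) 𝓘(ℂ, E) ∞
      (uncurry fun g x : G => g * x * g⁻¹) :=
    (contMDiff_fst.mul contMDiff_snd).mul contMDiff_fst.inv
  have h1 := ContMDiffAt.mfderiv (m := ∞) (n := ∞) (fun g x : G => g * x * g⁻¹)
    (fun _ : G => (1 : G)) (x₀ := g₀) (hc _) contMDiffAt_const (by simp)
  refine h1.congr_of_eventuallyEq (Eventually.of_forall fun g => ?_)
  have hg : ∀ g : G, g * 1 * g⁻¹ = 1 := fun g => by simp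
  have hs : (1 : G) ∈ (chartAt E (1 : G)).source := mem_chart_source E 1
  -- Both base points, `1` and `g * 1 * g⁻¹`, are `1`, so the coordinate changes of the tangent
  -- bundle are identities.
  have key := inTangentCoordinates_eq (I := 𝓘(ℂ, E)) (I' := 𝓘(ℂ, E)) (fun _ : G => (1 : G))
    (fun g : G => g * 1 * g⁻¹) (fun g => (Ad g : E →L[ℂ] E)) (x₀ := g₀) (x := g) hs
    (by simpa only [hg] using hs)
  refine Eq.symm (Eq.trans key ?_)
  simp only [hg]
  ext v
  simp only [ContinuousLinearMap.comp_apply]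
  rw [(tangentBundleCore 𝓘(ℂ, E) G).coordChange_self (achart E (1 : G)) 1 hs,
    (tangentBundleCore 𝓘(ℂ, E) G).coordChange_self (achart E (1 : G)) 1 hs]

theorem coadj_mul (g h : G) (z : E →L[ℂ] ℂ) : coadj (g * h) z = coadj h (coadj g z) := by
  ext X
  simp [coadj_apply, Ad_mul]

theorem isOrbitMap_coadj (z : E →L[ℂ] ℂ) :
    IsOrbitMap E (coadjL E : G → _) (fun g => coadj g z) where
  contMDiff := ((ContinuousLinearMap.compL ℂ E E ℂ) z).contMDiff.comp contMDiff_Ad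
  map_mul x g := coadj_mul x g z
  act_inv g v := by
    rw [coadjL_apply, coadjL_apply, ← coadj_mul, inv_mul_cancel, coadj_one]

/-! ### The derivative of the adjoint representation is the Lie bracket -/

variable (E G) in
/-- The multiplication of the group in the chart at `1`. -/
def chartMul (p : E × E) : E :=
  extChartAt 𝓘(ℂ, E) (1 : G) ((extChartAt 𝓘(ℂ, E) (1 : G)).symm p.1 *
    (extChartAt 𝓘(ℂ, E) (1 : G)).symm p.2)

theorem contMDiffAt_chart_symm {x : E} (hx : x ∈ (extChartAt 𝓘(ℂ, E) (1 : G)).target) :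
    ContMDiffAt 𝓘(ℂ, E) 𝓘(ℂ, E) ∞ (extChartAt 𝓘(ℂ, E) (1 : G)).symm x :=
  (contMDiffOn_extChartAt_symm (1 : G)).contMDiffAt ((isOpen_extChartAt_target 1).mem_nhds hx)

theorem contDiffAt_chartMul {x y : E} (hx : x ∈ (extChartAt 𝓘(ℂ, E) (1 : G)).target)
    (hy : y ∈ (extChartAt 𝓘(ℂ, E) (1 : G)).target)
    (hxy : (extChartAt 𝓘(ℂ, E) (1 : G)).symm x * (extChartAt 𝓘(ℂ, E) (1 : G)).symm y ∈
      (extChartAt 𝓘(ℂ, E) (1 : G)).source) : ContDiffAt ℂ ∞ (chartMul E G) (x, y) := by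
  rw [← contMDiffAt_iff_contDiffAt]
  have h1 : ContMDiffAt 𝓘(ℂ, E × E) 𝓘(ℂ, E) ∞
      (fun p : E × E => (extChartAt 𝓘(ℂ, E) (1 : G)).symm p.1) (x, y) :=
    ContMDiffAt.comp (x, y) (contMDiffAt_chart_symm hx) contDiff_fst.contMDiff.contMDiffAt
  have h2 : ContMDiffAt 𝓘(ℂ, E × E) 𝓘(ℂ, E) ∞
      (fun p : E × E => (extChartAt 𝓘(ℂ, E) (1 : G)).symm p.2) (x, y) :=
    ContMDiffAt.comp (x, y) (contMDiffAt_chart_symm hy) contDiff_snd.contMDiff.contMDiffAt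
  exact ContMDiffAt.comp (x, y)
    (contMDiffAt_extChartAt' (by simpa only [extChartAt_source] using hxy)) (h1.mul h2)

theorem mdifferentiableAt_chart {x : E}
    (hx : x ∈ (extChartAt 𝓘(ℂ, E) (1 : G)).target) :
    MDifferentiableAt 𝓘(ℂ, E) 𝓘(ℂ, E)
      (extChartAt 𝓘(ℂ, E) (1 : G)) ((extChartAt 𝓘(ℂ, E) (1 : G)).symm x) :=
  mdifferentiableAt_extChartAt (by simpa only [extChartAt_source] using
    (extChartAt 𝓘(ℂ, E) (1 : G)).map_target hx)

theorem modelDeriv_chart_mul_left {x : E} (hx : x ∈ (extChartAt 𝓘(ℂ, E) (1 : G)).target) (w : E) :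
    modelDeriv ℂ E E (fun y : G => extChartAt 𝓘(ℂ, E) (1 : G)
      ((extChartAt 𝓘(ℂ, E) (1 : G)).symm x * y)) 1 w =
    fderiv ℂ (chartMul E G) (x, extChartAt 𝓘(ℂ, E) (1 : G) 1) (0, w) := by
  set φ := extChartAt 𝓘(ℂ, E) (1 : G) with hφ
  have hφ1 : φ.symm (φ 1) = 1 := extChartAt_to_inv 1
  have hd : MDifferentiableAt 𝓘(ℂ, E) 𝓘(ℂ, E) (fun y : G => φ (φ.symm x * y)) 1 :=
    MDifferentiableAt.comp (1 : G) (by rw [mul_one]; exact mdifferentiableAt_chart hx)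
      ((contMDiff_mul_left (n := ∞)).mdifferentiable (by simp) _)
  rw [modelDeriv_eq_fderiv_chart hd]
  have hm : DifferentiableAt ℂ (chartMul E G) (x, φ 1) :=
    (contDiffAt_chartMul hx (mem_extChartAt_target 1) (by
      rw [← hφ, hφ1, mul_one]; exact φ.map_target hx)).differentiableAt (by simp)
  have h3 := hm.hasFDerivAt.comp (φ 1) (hasFDerivAt_prodMk_right x (φ 1))
  exact DFunLike.congr_fun h3.fderiv w

theorem modelDeriv_chart_mul_right {x : E} (hx : x ∈ (extChartAt 𝓘(ℂ, E) (1 : G)).target) (w : E) :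
    modelDeriv ℂ E E (fun y : G => extChartAt 𝓘(ℂ, E) (1 : G)
      (y * (extChartAt 𝓘(ℂ, E) (1 : G)).symm x)) 1 w =
    fderiv ℂ (chartMul E G) (extChartAt 𝓘(ℂ, E) (1 : G) 1, x) (w, 0) := by
  set φ := extChartAt 𝓘(ℂ, E) (1 : G) with hφ
  have hφ1 : φ.symm (φ 1) = 1 := extChartAt_to_inv 1
  have hd : MDifferentiableAt 𝓘(ℂ, E) 𝓘(ℂ, E) (fun y : G => φ (y * φ.symm x)) 1 :=
    MDifferentiableAt.comp (1 : G) (by rw [one_mul]; exact mdifferentiableAt_chart hx)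
      ((contMDiff_mul_right (n := ∞)).mdifferentiable (by simp) _)
  rw [modelDeriv_eq_fderiv_chart hd]
  have hm : DifferentiableAt ℂ (chartMul E G) (φ 1, x) :=
    (contDiffAt_chartMul (mem_extChartAt_target 1) hx (by
      rw [← hφ, hφ1, one_mul]; exact φ.map_target hx)).differentiableAt (by simp)
  have h3 := HasFDerivAt.comp (f := fun y => (y, x)) (φ 1) hm.hasFDerivAt
    (hasFDerivAt_prodMk_left (φ 1) x)
  exact DFunLike.congr_fun h3.fderiv w

theorem modelDeriv_chart_one :
    modelDeriv ℂ E E (extChartAt 𝓘(ℂ, E) (1 : G)) (1 : G) = ContinuousLinearMap.id ℂ E := by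
  set φ := extChartAt 𝓘(ℂ, E) (1 : G) with hφ
  have hφd : MDifferentiableAt 𝓘(ℂ, E) 𝓘(ℂ, E) φ (1 : G) :=
    mdifferentiableAt_extChartAt (mem_chart_source E 1)
  rw [modelDeriv_eq_fderiv_chart hφd]
  have : (fun y => extChartAt 𝓘(ℂ, E) (φ 1) (φ (φ.symm y))) =ᶠ[𝓝 (φ 1)] fun y => y := by
    filter_upwards [(isOpen_extChartAt_target (I := 𝓘(ℂ, E)) (1 : G)).mem_nhds
      (mem_extChartAt_target 1)] with y hy
    exact φ.right_inv hy
  rw [← hφ, this.fderiv_eq]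
  exact fderiv_fun_id

variable (E G) in
/-- A left invariant vector field in the chart at `1`. -/
def chartField (u : E) : E → E :=
  VectorField.mpullbackWithin 𝓘(ℂ, E) 𝓘(ℂ, E) (extChartAt 𝓘(ℂ, E) (1 : G)).symm
    (mulInvariantVectorField (I := 𝓘(ℂ, E)) (G := G) u) (range 𝓘(ℂ, E))

/-- With `m` the multiplication in the chart and `e` the coordinate of `1`, the left invariant field
of `u` is `x ↦ ∂₂m(x, e) u`, with value `u` at `e`. The formula is the bracket of two such vector
fields at `e`. -/
theorem bracket_eq_chartMul [FiniteDimensional ℂ E] (v w : E) :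
    bracket E G v w =
      fderiv ℂ (fun x => fderiv ℂ (chartMul E G) (x, extChartAt 𝓘(ℂ, E) (1 : G) 1) (0, w))
        (extChartAt 𝓘(ℂ, E) (1 : G) 1) v -
      fderiv ℂ (fun x => fderiv ℂ (chartMul E G) (x, extChartAt 𝓘(ℂ, E) (1 : G) 1) (0, v))
        (extChartAt 𝓘(ℂ, E) (1 : G) 1) w := by
  set φ := extChartAt 𝓘(ℂ, E) (1 : G) with hφ
  have hφ1 : φ.symm (φ 1) = 1 := extChartAt_to_inv 1
  have hb : bracket E G v w = (modelDeriv ℂ E E φ (1 : G)).inverse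
      (VectorField.lieBracketWithin ℂ
      (chartField E G v)
      (chartField E G w)
      (φ.symm ⁻¹' univ ∩ range 𝓘(ℂ, E)) (φ 1)) := rfl
  have hφid : modelDeriv ℂ E E φ (1 : G) = ContinuousLinearMap.id ℂ E := modelDeriv_chart_one
  have hpull : ∀ u : E, ∀ x ∈ φ.target, chartField E G u x =
      fderiv ℂ (chartMul E G) (x, φ 1) (0, u) := by
    intro u x hx
    rw [← modelDeriv_chart_mul_left hx u]
    have h0 := modelDeriv_comp (g := φ) (f := fun y : G => φ.symm x * y) 1
      (by rw [mul_one]; exact mdifferentiableAt_chart hx)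
      ((contMDiff_mul_left (n := ∞)).mdifferentiable (by simp) _)
    rw [mul_one] at h0
    rw [← hφ, h0]
    have h1 := mfderiv_extChartAt_comp_mfderivWithin_extChartAt_symm (I := 𝓘(ℂ, E)) hx
    have h2 := mfderivWithin_extChartAt_symm_comp_mfderiv_extChartAt (I := 𝓘(ℂ, E)) hx
    change (mfderivWithin 𝓘(ℂ, E) 𝓘(ℂ, E) φ.symm (range 𝓘(ℂ, E)) x).inverse _ = _
    rw [ContinuousLinearMap.inverse_eq h2 h1]
    rfl
  rw [hb, hφid, ContinuousLinearMap.inverse_id, preimage_univ, univ_inter,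
    modelWithCornersSelf_coe, range_id, VectorField.lieBracketWithin_univ]
  have hev : ∀ u : E, chartField E G u =ᶠ[𝓝 (φ 1)]
      fun x => fderiv ℂ (chartMul E G) (x, φ 1) (0, u) := by
    intro u
    filter_upwards [(isOpen_extChartAt_target (I := 𝓘(ℂ, E)) (1 : G)).mem_nhds
      (mem_extChartAt_target 1)] with x hx
    exact hpull u x hx
  rw [Filter.EventuallyEq.lieBracket_vectorField_eq (hev v) (hev w)]
  have hv0 : ∀ u : E, fderiv ℂ (chartMul E G) (φ 1, φ 1) (0, u) = u := by
    intro u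
    rw [← modelDeriv_chart_mul_left (mem_extChartAt_target 1) u, ← hφ, hφ1]
    simp only [one_mul]
    rw [hφid]
    rfl
  rw [VectorField.lieBracket, hv0, hv0]
  rfl

/-- The left translate of `w` to `x` is the right translate of `Ad x w`: in the chart, `∂₁m(e, x)(Ad
x w) = ∂₂m(x, e) w`. Differentiating at `e` along `v` expresses the derivative of `Ad` by mixed
second derivatives of `m`; their symmetry turns the result into `bracket_eq_chartMul`. -/
theorem modelDeriv_Ad [FiniteDimensional ℂ E] (v w : E) :
    modelDeriv ℂ E (E →L[ℂ] E) (Ad : G → E →L[ℂ] E) 1 v w = bracket E G v w := by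
  set φ := extChartAt 𝓘(ℂ, E) (1 : G) with hφ
  have hφ1 : φ.symm (φ 1) = 1 := extChartAt_to_inv 1
  have hAdd : MDifferentiableAt 𝓘(ℂ, E) 𝓘(ℂ, E →L[ℂ] E) (Ad : G → E →L[ℂ] E) 1 :=
    contMDiff_Ad.mdifferentiable (by simp) _
  have ha : DifferentiableAt ℂ (fun x => Ad (E := E) (φ.symm x)) (φ 1) := by
    rw [← mdifferentiableAt_iff_differentiableAt]
    refine MDifferentiableAt.comp (φ 1) (by rw [hφ1]; exact hAdd)
      ((contMDiffAt_chart_symm (mem_extChartAt_target 1)).mdifferentiableAt (by simp))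
  have hD : modelDeriv ℂ E (E →L[ℂ] E) (Ad : G → E →L[ℂ] E) 1 =
      fderiv ℂ (fun x => Ad (E := E) (φ.symm x)) (φ 1) := by
    rw [modelDeriv_eq_fderiv_chart hAdd]
    rfl
  have hm : ContDiffAt ℂ ∞ (chartMul E G) (φ 1, φ 1) :=
    contDiffAt_chartMul (mem_extChartAt_target 1) (mem_extChartAt_target 1) (by
      rw [← hφ, hφ1, one_mul]; exact mem_extChartAt_source 1)
  have hm2 : DifferentiableAt ℂ (fderiv ℂ (chartMul E G)) (φ 1, φ 1) :=
    (hm.fderiv_right (m := ∞) (by simp)).differentiableAt (by simp)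
  set B := fderiv ℂ (fderiv ℂ (chartMul E G)) (φ 1, φ 1) with hB
  have hsymm : ∀ p q, B p q = B q p :=
    (hm.isSymmSndFDerivAt (by rw [minSmoothness_of_isRCLikeNormedField]; exact WithTop.coe_le_coe.2 (le_top : (2 : ℕ∞) ≤ ⊤)))
  have hleft : ∀ u : E, HasFDerivAt (fun x => fderiv ℂ (chartMul E G) (x, φ 1) (0, u))
      (((ContinuousLinearMap.apply ℂ E ((0 : E), u)).comp B).comp
        (ContinuousLinearMap.inl ℂ E E)) (φ 1) := fun u =>
    HasFDerivAt.comp (f := fun x => (x, φ 1)) (φ 1)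
      ((ContinuousLinearMap.apply ℂ E ((0 : E), u)).hasFDerivAt.comp (φ 1, φ 1) hm2.hasFDerivAt)
      (hasFDerivAt_prodMk_left (φ 1) (φ 1))
  have hright : HasFDerivAt (fun x => fderiv ℂ (chartMul E G) (φ 1, x))
      (B.comp (ContinuousLinearMap.inr ℂ E E)) (φ 1) :=
    hm2.hasFDerivAt.comp (φ 1) (hasFDerivAt_prodMk_right (φ 1) (φ 1))
  have harg : HasFDerivAt (fun x => (Ad (E := E) (φ.symm x) w, (0 : E)))
      ((ContinuousLinearMap.inl ℂ E E).comp ((ContinuousLinearMap.apply ℂ E w).comp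
        (fderiv ℂ (fun x => Ad (E := E) (φ.symm x)) (φ 1)))) (φ 1) :=
    (ContinuousLinearMap.inl ℂ E E).hasFDerivAt.comp (φ 1)
      ((ContinuousLinearMap.apply ℂ E w).hasFDerivAt.comp (φ 1) ha.hasFDerivAt)
  have heq : (fun x => fderiv ℂ (chartMul E G) (φ 1, x) (Ad (E := E) (φ.symm x) w, (0 : E)))
      =ᶠ[𝓝 (φ 1)] fun x => fderiv ℂ (chartMul E G) (x, φ 1) (0, w) := by
    filter_upwards [(isOpen_extChartAt_target (I := 𝓘(ℂ, E)) (1 : G)).mem_nhds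
      (mem_extChartAt_target 1)] with x hx
    rw [← modelDeriv_chart_mul_left hx, ← modelDeriv_chart_mul_right hx, Ad_eq]
    have h0 := modelDeriv_comp (g := fun y => φ (y * φ.symm x))
      (f := fun y : G => φ.symm x * y * (φ.symm x)⁻¹) 1 (by
        rw [mul_one, mul_inv_cancel]
        exact MDifferentiableAt.comp (1 : G) (by rw [one_mul]; exact mdifferentiableAt_chart hx)
          ((contMDiff_mul_right (n := ∞)).mdifferentiable (by simp) _))
      (mdifferentiable_conj (E := E) (φ.symm x) 1)
    simp only [inv_mul_cancel_right, mul_one, mul_inv_cancel] at h0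
    rw [← hφ, h0]
    rfl
  have hfd := (hright.clm_apply harg).unique (heq.hasFDerivAt_iff.2 (hleft w))
  have hv0 : ∀ u : E, fderiv ℂ (chartMul E G) (φ 1, φ 1) (u, 0) = u := by
    intro u
    rw [← modelDeriv_chart_mul_right (mem_extChartAt_target 1) u, ← hφ, hφ1]
    simp only [mul_one]
    rw [modelDeriv_chart_one]
    rfl
  have h1 := DFunLike.congr_fun hfd v
  simp only [hφ1, Ad_one, add_apply, ContinuousLinearMap.comp_apply,
    ContinuousLinearMap.flip_apply, ContinuousLinearMap.apply_apply, ContinuousLinearMap.inl_apply,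
    ContinuousLinearMap.inr_apply, hv0, ContinuousLinearMap.id_apply] at h1
  rw [bracket_eq_chartMul, ← hφ, (hleft w).fderiv, (hleft v).fderiv, hD]
  simp only [ContinuousLinearMap.comp_apply, ContinuousLinearMap.apply_apply,
    ContinuousLinearMap.inl_apply]
  rw [← h1, hsymm (w, 0) (0, v)]
  abel

/-! ### The differential of the orbit maps -/

theorem modelDeriv_coadj_one [FiniteDimensional ℂ E] (z : E →L[ℂ] ℂ) (X : E) :
    modelDeriv ℂ E (E →L[ℂ] ℂ) (fun g : G => coadj g z) 1 X = sharp G z X := by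
  have h := modelDeriv_clm_comp ((ContinuousLinearMap.compL ℂ E E ℂ) z)
    (contMDiff_Ad.mdifferentiable (by simp) (1 : G))
  refine (DFunLike.congr_fun h X).trans ?_
  ext Y
  exact congrArg z (modelDeriv_Ad X Y)

/-- Since `coadj (g * y) z = coadj y (coadj g z)`, left translation reduces the differential at `g`
to the one at `1` of the orbit map of `coadj g z`. -/
theorem modelDeriv_coadj [FiniteDimensional ℂ E] (z : E →L[ℂ] ℂ) (g : G) (X : E) :
    modelDeriv ℂ E (E →L[ℂ] ℂ) (fun g : G => coadj g z) g
      (modelDeriv ℂ E E (fun y => g * y) 1 X) = sharp G (coadj g z) X := by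
  have h := modelDeriv_comp (g := fun g : G => coadj g z) (f := fun y => g * y) 1
    ((isOrbitMap_coadj z).contMDiff.mdifferentiable (by simp) _)
    ((contMDiff_mul_left (n := ∞)).mdifferentiable (by simp) _)
  simp only [mul_one, coadj_mul] at h
  rw [← modelDeriv_coadj_one, h]
  rfl

theorem range_modelDeriv_coadj [FiniteDimensional ℂ E] (z : E →L[ℂ] ℂ) (g : G) :
    LinearMap.range (modelDeriv ℂ E (E →L[ℂ] ℂ) (fun g : G => coadj g z) g).toLinearMap =
      charSubspace G (coadj g z) := by
  ext u
  constructor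
  · rintro ⟨v, rfl⟩
    obtain ⟨X, rfl⟩ := surjective_modelDeriv_mul_left (𝕜 := ℂ) (E := E) g 1 v
    exact ⟨X, (modelDeriv_coadj z g X).symm⟩
  · rintro ⟨X, rfl⟩
    exact ⟨_, modelDeriv_coadj z g X⟩

end Adjoint

/-! ### Regular points have commutative stabilizers -/

section Regular

/-- If the rank of `A + t C` is maximal at `t = 0`, then `C` maps the kernel of `A` to the range
of `A`. -/
theorem mem_range_of_finrank_le {E F : Type*} [AddCommGroup E] [Module ℂ E]
    [NormedAddCommGroup F] [NormedSpace ℂ F] [FiniteDimensional ℂ F] (A C : E →ₗ[ℂ] F)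
    (h : ∀ t : ℂ, Module.finrank ℂ (LinearMap.range (A + t • C)) ≤
      Module.finrank ℂ (LinearMap.range A)) {X : E} (hX : A X = 0) : C X ∈ LinearMap.range A := by
  by_contra hC
  set r := Module.finrank ℂ (LinearMap.range A) with hr
  let b : Module.Basis (Fin r) ℂ (LinearMap.range A) := Module.finBasis ℂ (LinearMap.range A)
  choose x hx using fun i => (b i).2
  -- If `C X` were outside the range of `A`, these `r + 1` vectors would be independent at `t = 0`,
  -- hence for small `t`. For `t ≠ 0` all of them lie in the range of `A + t C`, as `C X = (A + t
  -- C)(t⁻¹ X)`, against the bound `r`.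
  let v : ℂ → Option (Fin r) → F := fun t o => Option.casesOn' o (C X) fun i => (A + t • C) (x i)
  have hb : LinearIndependent ℂ fun i => ((b i : LinearMap.range A) : F) :=
    b.linearIndependent.map' _ (Submodule.ker_subtype _)
  have h0 : LinearIndependent ℂ (v 0) := by
    have h1 : v 0 = fun o => Option.casesOn' o (C X) fun i => ((b i : LinearMap.range A) : F) := by
      funext o
      cases o with
      | none => rfl
      | some i =>
        change (A + (0 : ℂ) • C) (x i) = b i
        rw [zero_smul, add_zero]
        exact hx i
    rw [h1]
    refine LinearIndependent.option hb fun hmem => hC ?_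
    refine Submodule.span_le.2 ?_ hmem
    rintro _ ⟨i, rfl⟩
    exact (b i).2
  have hc : Continuous v := by
    refine continuous_pi fun o => ?_
    cases o with
    | none => exact continuous_const
    | some i =>
      simp only [v, Option.casesOn'_some, LinearMap.add_apply, LinearMap.smul_apply]
      fun_prop
  have hev : ∀ᶠ t in 𝓝 (0 : ℂ), LinearIndependent ℂ (v t) :=
    hc.continuousAt.eventually (isOpen_setOfPred_linearIndependent.mem_nhds h0)
  obtain ⟨t, ht, ht0⟩ :=
    ((hev.filter_mono nhdsWithin_le_nhds).and (self_mem_nhdsWithin (s := {0}ᶜ))).exists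
  have hspan := finrank_span_eq_card ht
  have hle : Submodule.span ℂ (range (v t)) ≤ LinearMap.range (A + t • C) := by
    refine Submodule.span_le.2 ?_
    rintro _ ⟨o, rfl⟩
    cases o with
    | none =>
      refine ⟨t⁻¹ • X, ?_⟩
      change (A + t • C) (t⁻¹ • X) = C X
      rw [LinearMap.add_apply, map_smul, hX, LinearMap.smul_apply, map_smul, smul_zero, zero_add,
        smul_inv_smul₀ ht0]
    | some i => exact ⟨x i, rfl⟩
  have h2 := (Submodule.finrank_mono hle).trans (h t)
  rw [hspan, Fintype.card_option, Fintype.card_fin] at h2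
  omega

variable {E : Type u} [NormedAddCommGroup E] [NormedSpace ℂ E] 
  {G : Type*} [TopologicalSpace G] [ChartedSpace E G] [Group G] [LieGroup 𝓘(ℂ, E) ∞ G]

theorem coadjL_injective (g : G) : Injective (coadjL E g) :=
  LeftInverse.injective (g := coadjL E g⁻¹) fun v => by
    rw [coadjL_apply, coadjL_apply, ← coadj_mul, mul_inv_cancel, coadj_one]

variable [FiniteDimensional ℂ E]

theorem sharp_skew (z : E →L[ℂ] ℂ) (X Y : E) : sharp G z X Y = -sharp G z Y X := by
  rw [sharp_apply, sharp_apply, bracket_skew, map_neg]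

/-- For every `w` the rank of `c_{z + t w}^♯ = c_z^♯ + t c_w^♯` is maximal at `t = 0`, so `c_w^♯ X =
c_z^♯ U` for some `U`. Then `w([X, Y]) = z([U, Y]) = 0`, because `Y` lies in the stabilizer of `z`;
and `w` is arbitrary. -/
theorem bracket_eq_zero_of_regular {z : E →L[ℂ] ℂ} (hz : z ∉ Sing E G) {X Y : E}
    (hX : sharp G z X = 0) (hY : sharp G z Y = 0) : bracket E G X Y = 0 := by
  refine SeparatingDual.eq_zero_of_forall_dual_eq_zero (R := ℂ) fun w => ?_
  have hadd : ∀ t : ℂ, sharp G (z + t • w) = sharp G z + t • sharp G w := fun t => by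
    ext U W
    simp
  have hmem : sharp G w X ∈ LinearMap.range (sharp G z) := by
    refine mem_range_of_finrank_le _ _ (fun t => ?_) hX
    rw [← hadd]
    by_contra hlt
    exact hz ⟨z + t • w, not_le.1 hlt⟩
  obtain ⟨U, hU⟩ := hmem
  rw [← sharp_apply (G := G), ← hU, sharp_skew, hY]
  simp

theorem charSubspace_coadj (z : E →L[ℂ] ℂ) (g : G) :
    charSubspace G (coadj g z) = (charSubspace G z).map (coadjL E g).toLinearMap := by
  rw [← range_modelDeriv_coadj, (isOrbitMap_coadj z).range_modelDeriv g, range_modelDeriv_coadj,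
    coadj_one]

theorem coadj_not_mem_Sing {z : E →L[ℂ] ℂ} (hz : z ∉ Sing E G) (g : G) :
    coadj g z ∉ Sing E G := by
  rintro ⟨w, hw⟩
  refine hz ⟨w, ?_⟩
  rw [charSubspace_coadj] at hw
  rwa [← (Submodule.equivMapOfInjective _ (coadjL_injective g) _).finrank_eq] at hw

end Regular

/-! ### The real form -/

section RealForm

variable {E₀ : Type*} [NormedAddCommGroup E₀] [NormedSpace ℝ E₀]
  {G₀ : Type*} [TopologicalSpace G₀] [ChartedSpace E₀ G₀] [Group G₀]
  {E : Type u} [NormedAddCommGroup E] [NormedSpace ℂ E]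
  {G : Type*} [TopologicalSpace G] [ChartedSpace E G] [Group G]
  {ι : G₀ →* G}

theorem IsComplexification.mem_range_iff (hι : IsComplexification E₀ E ι) (Z : E) :
    (∃ X, differentialAtOne E₀ E ι X = Z) ↔ (hι.equiv.symm Z).2 = 0 := by
  constructor
  · rintro ⟨X, rfl⟩
    have : differentialAtOne E₀ E ι X = hι.equiv (X, 0) := by simp [hι.equiv_apply]
    rw [this, LinearEquiv.symm_apply_apply]
  · intro h
    refine ⟨(hι.equiv.symm Z).1, ?_⟩
    conv_rhs => rw [← hι.equiv.apply_symm_apply Z, ← Prod.mk.eta (p := hι.equiv.symm Z), h,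
      hι.equiv_apply]
    simp

theorem IsComplexification.conj_real_add (hι : IsComplexification E₀ E ι) (X Y : E₀) :
    hι.conj (differentialAtOne E₀ E ι X + Complex.I • differentialAtOne E₀ E ι Y) =
      differentialAtOne E₀ E ι X - Complex.I • differentialAtOne E₀ E ι Y := by
  rw [← hι.equiv_apply, IsComplexification.conj, LinearEquiv.symm_apply_apply, hι.equiv_apply,
    map_neg, smul_neg, sub_eq_add_neg]

theorem IsComplexification.conj_real (hι : IsComplexification E₀ E ι) (X : E₀) :
    hι.conj (differentialAtOne E₀ E ι X) = differentialAtOne E₀ E ι X := by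
  simpa using hι.conj_real_add X 0

theorem IsComplexification.exists_real_add (hι : IsComplexification E₀ E ι) (Z : E) :
    ∃ X Y, Z = differentialAtOne E₀ E ι X + Complex.I • differentialAtOne E₀ E ι Y :=
  ⟨_, _, (hι.equiv.apply_symm_apply Z).symm⟩

theorem IsComplexification.conj_sub (hι : IsComplexification E₀ E ι) (Z W : E) :
    hι.conj (Z - W) = hι.conj Z - hι.conj W := by
  have h := hι.conj_smul (-1) W
  rw [sub_eq_add_neg, hι.conj_add, ← neg_one_smul ℂ W, h]
  simp [sub_eq_add_neg]

/-- The coadjoint action of the real group, by real linear maps. -/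
def realCoadjL (ι : G₀ →* G) (h : G₀) : (E →L[ℂ] ℂ) →L[ℝ] (E →L[ℂ] ℂ) :=
  (coadjL E (ι h)).restrictScalars ℝ

variable [LieGroup 𝓘(ℂ, E) ∞ G]

theorem IsComplexification.contMDiff_Ad (hι : IsComplexification E₀ E ι) :
    ContMDiff 𝓘(ℝ, E₀) 𝓘(ℝ, E →L[ℂ] E) ∞ (fun h => Ad (ι h) : G₀ → E →L[ℂ] E) :=
  (contMDiff_real_of_complex CoadjointCR.contMDiff_Ad).comp hι.contMDiff

theorem IsComplexification.modelDeriv_Ad (hι : IsComplexification E₀ E ι) (X : E₀) :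
    modelDeriv ℝ E₀ (E →L[ℂ] E) (fun h => Ad (ι h) : G₀ → E →L[ℂ] E) 1 X =
      modelDeriv ℂ E (E →L[ℂ] E) (Ad : G → E →L[ℂ] E) 1 (differentialAtOne E₀ E ι X) := by
  have h := modelDeriv_comp (g := (Ad : G → E →L[ℂ] E)) (f := ι) 1
    ((contMDiff_real_of_complex CoadjointCR.contMDiff_Ad).mdifferentiable (by simp) _)
    (hι.contMDiff.mdifferentiable (by simp) 1)
  rw [map_one, modelDeriv_real_of_complex
    (CoadjointCR.contMDiff_Ad.mdifferentiable (by simp) _)] at h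
  exact DFunLike.congr_fun h X

variable [LieGroup 𝓘(ℝ, E₀) ∞ G₀]

/-- Differentiate `ι (h * x * h⁻¹) = ι h * ι x * (ι h)⁻¹` at `x = 1`. -/
theorem IsComplexification.Ad_real (hι : IsComplexification E₀ E ι) (h : G₀) (X : E₀) :
    ∃ Y, differentialAtOne E₀ E ι Y = Ad (ι h) (differentialAtOne E₀ E ι X) := by
  have hd : ∀ x, MDifferentiableAt 𝓘(ℝ, E₀) 𝓘(ℝ, E) ι x :=
    hι.contMDiff.mdifferentiable (by simp)
  have hc : MDifferentiableAt 𝓘(ℝ, E₀) 𝓘(ℝ, E₀) (fun x : G₀ => h * x * h⁻¹) 1 :=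
    (contMDiff_mul_right.comp (contMDiff_mul_left (n := ∞))).mdifferentiable (by simp) 1
  have hC : MDifferentiableAt 𝓘(ℝ, E) 𝓘(ℝ, E) (fun x : G => ι h * x * (ι h)⁻¹) (ι 1) :=
    (contMDiff_real_of_complex (contMDiff_conj (ι h))).mdifferentiable (by simp) _
  have h1 := modelDeriv_comp (g := ι) (f := fun x : G₀ => h * x * h⁻¹) 1 (hd _) hc
  have h2 := modelDeriv_comp (g := fun x : G => ι h * x * (ι h)⁻¹) (f := ι) 1 hC (hd 1)
  rw [map_one, modelDeriv_real_of_complex (mdifferentiable_conj (ι h) 1)] at h2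
  simp only [mul_one, mul_inv_cancel] at h1
  have h3 : (fun x => ι (h * x * h⁻¹)) = fun x => ι h * ι x * (ι h)⁻¹ := by
    ext x
    simp
  rw [h3, h2] at h1
  exact ⟨_, (DFunLike.congr_fun h1 X).symm⟩

theorem IsComplexification.conj_Ad (hι : IsComplexification E₀ E ι) (h : G₀) (Z : E) :
    hι.conj (Ad (ι h) Z) = Ad (ι h) (hι.conj Z) := by
  obtain ⟨X, Y, rfl⟩ := hι.exists_real_add Z
  obtain ⟨X', hX'⟩ := hι.Ad_real h X
  obtain ⟨Y', hY'⟩ := hι.Ad_real h Y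
  rw [hι.conj_real_add, map_add, map_sub, map_smul, ← hX', ← hY', hι.conj_real_add]

variable [FiniteDimensional ℂ E]

theorem IsComplexification.conjDual_coadj (hι : IsComplexification E₀ E ι) (h : G₀)
    (z : E →L[ℂ] ℂ) : hι.conjDual (coadj (ι h) z) = coadj (ι h) (hι.conjDual z) := by
  ext Z
  change starRingEnd ℂ (z (Ad (ι h) (hι.conj Z))) = starRingEnd ℂ (z (hι.conj (Ad (ι h) Z)))
  rw [hι.conj_Ad]

/-- The imaginary part of `Ad (ι h) Y` vanishes for all `h` by `Ad_real`; its derivative at `h = 1`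
along `X` is the imaginary part of `[X, Y]`. -/
theorem IsComplexification.bracket_real (hι : IsComplexification E₀ E ι) (X Y : E₀) :
    ∃ Z, differentialAtOne E₀ E ι Z =
      bracket E G (differentialAtOne E₀ E ι X) (differentialAtOne E₀ E ι Y) := by
  rw [hι.mem_range_iff]
  have : FiniteDimensional ℝ E := FiniteDimensional.complexToReal E
  let q : E →L[ℝ] E₀ := LinearMap.toContinuousLinearMap
    (LinearMap.snd ℝ E₀ E₀ ∘ₗ hι.equiv.symm.toLinearMap)
  let ev : (E →L[ℂ] E) →L[ℝ] E :=
    (ContinuousLinearMap.apply ℂ E (differentialAtOne E₀ E ι Y)).restrictScalars ℝ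
  have h1 := modelDeriv_clm_comp (q.comp ev) (hι.contMDiff_Ad.mdifferentiable (by simp) 1)
  have h2 : (fun h => (q.comp ev) (Ad (ι h))) = fun _ => 0 :=
    funext fun h => (hι.mem_range_iff _).1 (hι.Ad_real h Y)
  rw [h2, modelDeriv_const] at h1
  have h3 := DFunLike.congr_fun h1 X
  rw [ContinuousLinearMap.comp_apply, hι.modelDeriv_Ad] at h3
  rw [← CoadjointCR.modelDeriv_Ad]
  exact h3.symm

theorem IsComplexification.conj_bracket (hι : IsComplexification E₀ E ι) (Z W : E) :
    hι.conj (bracket E G Z W) = bracket E G (hι.conj Z) (hι.conj W) := by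
  obtain ⟨X, Y, rfl⟩ := hι.exists_real_add Z
  obtain ⟨X', Y', rfl⟩ := hι.exists_real_add W
  obtain ⟨a, ha⟩ := hι.bracket_real X X'
  obtain ⟨b, hb⟩ := hι.bracket_real X Y'
  obtain ⟨c, hc⟩ := hι.bracket_real Y X'
  obtain ⟨d, hd⟩ := hι.bracket_real Y Y'
  rw [hι.conj_real_add, hι.conj_real_add]
  simp only [map_add, map_sub, map_smul, LinearMap.add_apply, LinearMap.sub_apply,
    LinearMap.smul_apply, ← ha, ← hb, ← hc, ← hd, hι.conj_add, hι.conj_smul, hι.conj_real,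
    Complex.conj_I]
  module

/-- The stabilizer condition that makes the orbit isotropic. -/
theorem IsComplexification.apply_bracket_eq_zero (hι : IsComplexification E₀ E ι)
    {z : E →L[ℂ] ℂ} (hz : z ∉ Sing E G) {X X' Y Y' : E₀}
    (hX : sharp G z (differentialAtOne E₀ E ι X') =
      Complex.I • sharp G z (differentialAtOne E₀ E ι X))
    (hY : sharp G z (differentialAtOne E₀ E ι Y') =
      Complex.I • sharp G z (differentialAtOne E₀ E ι Y)) :
    z (bracket E G (differentialAtOne E₀ E ι X) (differentialAtOne E₀ E ι Y)) = 0 := by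
  set δ := differentialAtOne E₀ E ι
  have hZ : sharp G z (δ X' - Complex.I • δ X) = 0 := by rw [map_sub, map_smul, hX, sub_self]
  have hW : sharp G z (δ Y' - Complex.I • δ Y) = 0 := by rw [map_sub, map_smul, hY, sub_self]
  have h0 := bracket_eq_zero_of_regular hz hZ hW
  have h1 := hι.conj_bracket (G := G) (δ X' - Complex.I • δ X) (δ Y' - Complex.I • δ Y)
  rw [h0] at h1
  have hc0 : hι.conj 0 = 0 := by simpa using hι.conj_smul 0 0
  rw [hc0, hι.conj_sub, hι.conj_sub, hι.conj_smul, hι.conj_smul] at h1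
  simp only [δ, hι.conj_real, Complex.conj_I] at h1
  have hZ' : ∀ W, z (bracket E G (δ X' - Complex.I • δ X) W) = 0 := fun W =>
    DFunLike.congr_fun hZ W
  have hW' : ∀ Z, z (bracket E G Z (δ Y' - Complex.I • δ Y)) = 0 := fun Z => by
    rw [bracket_skew, map_neg]
    exact neg_eq_zero.2 (DFunLike.congr_fun hW Z)
  have e1 := hZ' (δ Y')
  have e2 := hZ' (δ Y)
  have e3 := hW' (δ X')
  have e4 := congrArg z h1.symm
  simp only [δ, map_sub, map_smul, LinearMap.sub_apply, LinearMap.smul_apply, smul_eq_mul,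
    map_zero] at e1 e2 e3 e4 ⊢
  -- With `Z = X' - iX` and `W = Y' - iY` in the stabilizer, this is `z([X, Y]) = -z([Z̄, W̄])/4`;
  -- `e1`, `e2`, `e3` remove the terms containing `Z` or `W`, and `e4` is the vanishing of `z([Z̄,
  -- W̄])`.
  linear_combination (norm := (ring_nf; simp only [Complex.I_sq]; ring)) (-1 / 4 : ℂ) * e1 +
    (3 / 4 : ℂ) * Complex.I * e2 + (1 / 2 : ℂ) * e3 - (1 / 4 : ℂ) * e4

end RealForm

/-! ### The space `T^{1,0}` of a real subspace -/

section OneZero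

variable {W : Type*} [AddCommGroup W] [Module ℂ W]

/-- The largest complex subspace of a real subspace. -/
def holPart (T : Submodule ℝ W) : Submodule ℂ W where
  carrier := {w | w ∈ T ∧ Complex.I • w ∈ T}
  zero_mem' := by simp
  add_mem' ha hb := ⟨add_mem ha.1 hb.1, by rw [smul_add]; exact add_mem ha.2 hb.2⟩
  smul_mem' c w hw := by
    have h1 : ∀ c : ℂ, c • w = c.re • w + c.im • Complex.I • w := fun c => by
      conv_lhs => rw [← Complex.re_add_im c, add_smul, mul_smul, Complex.coe_smul, Complex.coe_smul]
    constructor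
    · rw [h1]
      exact add_mem (T.smul_mem _ hw.1) (T.smul_mem _ hw.2)
    · rw [← mul_smul, h1]
      exact add_mem (T.smul_mem _ hw.1) (T.smul_mem _ hw.2)

theorem tmul_eq_one_tmul_add (c : ℂ) (w : W) :
    (c ⊗ₜ[ℝ] w : ℂ ⊗[ℝ] W) = 1 ⊗ₜ (c.re • w) + Complex.I ⊗ₜ (c.im • w) := by
  rw [TensorProduct.tmul_smul, TensorProduct.tmul_smul, TensorProduct.smul_tmul',
    TensorProduct.smul_tmul', ← TensorProduct.add_tmul]
  congr 1
  apply Complex.ext <;> simp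

variable (W) in
/-- The isomorphism of `W` with `W^{1,0}`, up to a factor. -/
def toOneZero : W →ₗ[ℂ] ℂ ⊗[ℝ] W where
  toFun w := 1 ⊗ₜ w - Complex.I ⊗ₜ (Complex.I • w)
  map_add' v w := by simp only [smul_add, TensorProduct.tmul_add]; abel
  map_smul' c w := by
    have h1 : c • w = c.re • w + c.im • Complex.I • w := by
      conv_lhs => rw [← Complex.re_add_im c, add_smul, mul_smul, Complex.coe_smul, Complex.coe_smul]
    have h2 : Complex.I • c • w = c.re • Complex.I • w - c.im • w := by
      rw [h1, smul_add, smul_comm Complex.I c.re, smul_comm Complex.I c.im, ← mul_smul Complex.I,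
        Complex.I_mul_I, neg_one_smul, smul_neg, sub_eq_add_neg]
    rw [RingHom.id_apply, h2, h1, smul_sub, TensorProduct.smul_tmul', TensorProduct.smul_tmul',
      smul_eq_mul, smul_eq_mul, mul_one, tmul_eq_one_tmul_add c,
      tmul_eq_one_tmul_add (c * Complex.I)]
    simp only [TensorProduct.tmul_add, TensorProduct.tmul_sub, Complex.mul_re, Complex.mul_im,
      Complex.I_re, Complex.I_im, mul_zero, mul_one, zero_sub, add_zero, neg_smul,
      TensorProduct.tmul_neg]
    abel

theorem toOneZero_apply (w : W) :
    toOneZero W w = 1 ⊗ₜ[ℝ] w - Complex.I ⊗ₜ[ℝ] (Complex.I • w) := rfl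

theorem liftBaseChange_toOneZero (w : W) :
    LinearMap.liftBaseChange ℂ (LinearMap.id : W →ₗ[ℝ] W) (toOneZero W w) = (2 : ℂ) • w := by
  rw [toOneZero_apply, map_sub, LinearMap.liftBaseChange_tmul, LinearMap.liftBaseChange_tmul,
    LinearMap.id_apply, LinearMap.id_apply, ← mul_smul, Complex.I_mul_I, two_smul]
  simp

theorem toOneZero_injective : Injective (toOneZero W) := by
  intro v w h
  have := congrArg (LinearMap.liftBaseChange ℂ (LinearMap.id : W →ₗ[ℝ] W)) h
  rw [liftBaseChange_toOneZero, liftBaseChange_toOneZero] at this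
  exact smul_right_injective W (two_ne_zero : (2 : ℂ) ≠ 0) this

theorem exists_of_mem_baseChange {T : Submodule ℝ W} {u : ℂ ⊗[ℝ] W} (hu : u ∈ T.baseChange ℂ) :
    ∃ a ∈ T, ∃ b ∈ T, u = 1 ⊗ₜ a + Complex.I ⊗ₜ b := by
  rw [Submodule.baseChange_eq_span] at hu
  induction hu using Submodule.span_induction with
  | mem x hx =>
    obtain ⟨a, ha, rfl⟩ := hx
    exact ⟨a, ha, 0, T.zero_mem, by simp⟩
  | zero => exact ⟨0, T.zero_mem, 0, T.zero_mem, by simp⟩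
  | add x y _ _ hx hy =>
    obtain ⟨a, ha, b, hb, rfl⟩ := hx
    obtain ⟨a', ha', b', hb', rfl⟩ := hy
    refine ⟨a + a', add_mem ha ha', b + b', add_mem hb hb', ?_⟩
    simp only [TensorProduct.tmul_add]
    abel
  | smul c x _ hx =>
    obtain ⟨a, ha, b, hb, rfl⟩ := hx
    refine ⟨c.re • a - c.im • b, sub_mem (T.smul_mem _ ha) (T.smul_mem _ hb),
      c.im • a + c.re • b, add_mem (T.smul_mem _ ha) (T.smul_mem _ hb), ?_⟩
    rw [smul_add, TensorProduct.smul_tmul', TensorProduct.smul_tmul', smul_eq_mul, smul_eq_mul,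
      mul_one, tmul_eq_one_tmul_add c, tmul_eq_one_tmul_add (c * Complex.I)]
    simp only [TensorProduct.tmul_add, TensorProduct.tmul_sub, Complex.mul_re, Complex.mul_im,
      Complex.I_re, Complex.I_im, mul_zero, mul_one, zero_sub, add_zero, neg_smul,
      TensorProduct.tmul_neg]
    abel

/-- This replaces `T^{1,0}` by the complex subspace `T ∩ iT` of `W`, so that dimensions and isotropy
can be checked without tensor products. -/
theorem oneZeroPart_eq_map (T : Submodule ℝ W) :
    oneZeroPart T = (holPart T).map (toOneZero W) := by
  ext u
  constructor
  · rintro ⟨h1, h2⟩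
    obtain ⟨a, ha, b, hb, rfl⟩ := exists_of_mem_baseChange h1
    have h3 := Module.End.mem_eigenspace_iff.1 h2
    have h4 : (1 ⊗ₜ (Complex.I • a) + Complex.I ⊗ₜ (Complex.I • b) : ℂ ⊗[ℝ] W) =
        Complex.I ⊗ₜ a + (-1) ⊗ₜ b := by
      rw [map_add, LinearMap.baseChange_tmul, LinearMap.baseChange_tmul, smul_add,
        TensorProduct.smul_tmul', TensorProduct.smul_tmul', smul_eq_mul, smul_eq_mul, mul_one,
        Complex.I_mul_I] at h3
      exact h3
    -- The real part of the eigenvalue equation in the first tensor factor is `i a = -b`, so `b` is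
    -- determined by `a`.
    have h5 := congrArg (fun x => TensorProduct.lid ℝ W (LinearMap.rTensor W Complex.reLm x)) h4
    simp at h5
    refine ⟨a, ⟨ha, ?_⟩, ?_⟩
    · rw [h5]
      exact neg_mem hb
    · rw [toOneZero_apply, h5, TensorProduct.tmul_neg, sub_neg_eq_add]
  · rintro ⟨w, ⟨hw1, hw2⟩, rfl⟩
    refine ⟨?_, ?_⟩
    · exact sub_mem (Submodule.tmul_mem_baseChange_of_mem _ hw1)
        (Submodule.tmul_mem_baseChange_of_mem _ hw2)
    · refine Module.End.mem_eigenspace_iff.2 ?_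
      rw [toOneZero_apply, map_sub, LinearMap.baseChange_tmul, LinearMap.baseChange_tmul, smul_sub,
        TensorProduct.smul_tmul', TensorProduct.smul_tmul', smul_eq_mul, smul_eq_mul, mul_one,
        Complex.I_mul_I]
      change (1 ⊗ₜ (Complex.I • w) - Complex.I ⊗ₜ (Complex.I • Complex.I • w) : ℂ ⊗[ℝ] W) = _
      rw [← mul_smul, Complex.I_mul_I, neg_one_smul, TensorProduct.tmul_neg,
        TensorProduct.neg_tmul]
      abel

theorem finrank_oneZeroPart (T : Submodule ℝ W) :
    Module.finrank ℂ (oneZeroPart T) = Module.finrank ℂ (holPart T) := by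
  rw [oneZeroPart_eq_map]
  exact (Submodule.equivMapOfInjective _ toOneZero_injective _).symm.finrank_eq

theorem twoZeroForm_toOneZero (Ω : W →ₗ[ℂ] W →ₗ[ℂ] ℂ) (v w : W) :
    twoZeroForm Ω (toOneZero W v) (toOneZero W w) = 4 * Ω v w := by
  change Ω (LinearMap.liftBaseChange ℂ (LinearMap.id : W →ₗ[ℝ] W) (toOneZero W v))
    (LinearMap.liftBaseChange ℂ (LinearMap.id : W →ₗ[ℝ] W) (toOneZero W w)) = _
  rw [liftBaseChange_toOneZero, liftBaseChange_toOneZero]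
  simp only [map_smul, LinearMap.smul_apply, smul_eq_mul]
  ring

theorem oneZeroPart_le_skewOrthogonal {Ω : W →ₗ[ℂ] W →ₗ[ℂ] ℂ} {T : Submodule ℝ W}
    (h : ∀ v ∈ holPart T, ∀ w ∈ holPart T, Ω v w = 0) :
    oneZeroPart T ≤ skewOrthogonal Ω (oneZeroPart T) := by
  intro u hu
  refine ⟨hu.2, fun u' hu' => ?_⟩
  rw [oneZeroPart_eq_map] at hu hu'
  obtain ⟨v, hv, rfl⟩ := hu
  obtain ⟨w, hw, rfl⟩ := hu'
  rw [twoZeroForm_toOneZero, h v hv w hw, mul_zero]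

/-- An injective complex linear map commutes with `i` and so matches `T ∩ iT` with its image. It is
used for the differential of the inclusion of `M` and for the coadjoint action. -/
theorem finrank_holPart_of_injective {W' : Type*} [AddCommGroup W'] [Module ℂ W']
    {L : W →ₗ[ℂ] W'} (hL : Injective L) {T : Submodule ℝ W} {T' : Submodule ℝ W'}
    (h : ∀ w, w ∈ T' ↔ ∃ v ∈ T, L v = w) :
    Module.finrank ℂ (holPart T') = Module.finrank ℂ (holPart T) := by
  have h1 : holPart T' = (holPart T).map L := by
    ext w
    constructor
    · rintro ⟨h1, h2⟩
      obtain ⟨v, hv, rfl⟩ := (h w).1 h1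
      obtain ⟨v', hv', h3⟩ := (h _).1 h2
      rw [← map_smul] at h3
      rw [hL h3] at hv'
      exact ⟨v, ⟨hv, hv'⟩, rfl⟩
    · rintro ⟨v, ⟨h1, h2⟩, rfl⟩
      exact ⟨(h _).2 ⟨v, h1, rfl⟩, (h _).2 ⟨_, h2, map_smul _ _ _⟩⟩
  rw [h1]
  exact (Submodule.equivMapOfInjective _ hL _).symm.finrank_eq

end OneZero

section RealOrbit

variable {E₀ : Type*} [NormedAddCommGroup E₀] [NormedSpace ℝ E₀]
  {G₀ : Type*} [TopologicalSpace G₀] [ChartedSpace E₀ G₀] [Group G₀]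
  {E : Type u} [NormedAddCommGroup E] [NormedSpace ℂ E]
  {G : Type*} [TopologicalSpace G] [ChartedSpace E G] [Group G] [LieGroup 𝓘(ℂ, E) ∞ G]
  {ι : G₀ →* G}

/-! ### The orbits of the real group -/

theorem IsComplexification.isOrbitMap (hι : IsComplexification E₀ E ι) (z : E →L[ℂ] ℂ) :
    IsOrbitMap E₀ (realCoadjL (E := E) ι) (fun h => coadj (ι h) z) where
  contMDiff := (contMDiff_real_of_complex (isOrbitMap_coadj z).contMDiff).comp hι.contMDiff
  map_mul x h := by
    rw [map_mul]
    exact coadj_mul _ _ _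
  act_inv h v := by
    rw [realCoadjL, realCoadjL, map_inv]
    exact (isOrbitMap_coadj v).act_inv (ι h) v

variable [LieGroup 𝓘(ℝ, E₀) ∞ G₀] [FiniteDimensional ℂ E]

theorem IsComplexification.modelDeriv_coadj (hι : IsComplexification E₀ E ι) (z : E →L[ℂ] ℂ)
    (h : G₀) (X : E₀) :
    modelDeriv ℝ E₀ (E →L[ℂ] ℂ) (fun h => coadj (ι h) z) h
      (modelDeriv ℝ E₀ E₀ (fun y => h * y) 1 X) =
      sharp G (coadj (ι h) z) (differentialAtOne E₀ E ι X) := by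
  have h1 := modelDeriv_comp (g := fun h => coadj (ι h) z) (f := fun y => h * y) 1
    ((hι.isOrbitMap z).contMDiff.mdifferentiable (by simp) _)
    ((contMDiff_mul_left (n := ∞)).mdifferentiable (by simp) _)
  have h2 := modelDeriv_comp (g := fun g => coadj g (coadj (ι h) z)) (f := ι) 1
    ((contMDiff_real_of_complex (isOrbitMap_coadj _).contMDiff).mdifferentiable (by simp) _)
    (hι.contMDiff.mdifferentiable (by simp) 1)
  rw [map_one, modelDeriv_real_of_complex
    ((isOrbitMap_coadj _).contMDiff.mdifferentiable (by simp) _)] at h2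
  simp only [mul_one, map_mul, coadj_mul] at h1
  rw [h2] at h1
  have h3 := DFunLike.congr_fun h1 X
  exact h3.symm.trans (modelDeriv_coadj_one _ _)

theorem IsComplexification.mem_range_modelDeriv_coadj (hι : IsComplexification E₀ E ι)
    (z : E →L[ℂ] ℂ) (h : G₀) (u : E →L[ℂ] ℂ) :
    (∃ v, modelDeriv ℝ E₀ (E →L[ℂ] ℂ) (fun h => coadj (ι h) z) h v = u) ↔
      ∃ X, sharp G (coadj (ι h) z) (differentialAtOne E₀ E ι X) = u := by
  constructor
  · rintro ⟨v, rfl⟩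
    obtain ⟨X, rfl⟩ := surjective_modelDeriv_mul_left (𝕜 := ℝ) (E := E₀) h 1 v
    exact ⟨X, (hι.modelDeriv_coadj z h X).symm⟩
  · rintro ⟨X, rfl⟩
    exact ⟨_, hι.modelDeriv_coadj z h X⟩

/-! ### Invariance of the functions `g̃` -/

/-- The velocities of the orbit maps are of the form `c^♯ X`, which `dg` kills, so `g` is constant
along them over a ball in the chart of `G₀`. For one fixed `h` the equality holds on a whole
neighbourhood of `w`, so that it can be differentiated in `w'`. -/
theorem IsComplexification.casimir_eventually_invariant (hι : IsComplexification E₀ E ι)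
    {U : Set (E →L[ℂ] ℂ)} {g : (E →L[ℂ] ℂ) → ℂ} (hU : IsOpen U)
    (hg : IsHolomorphicCasimir G U g) {w : E →L[ℂ] ℂ} (hw : w ∈ U) :
    ∀ᶠ h in 𝓝 (1 : G₀), coadj (ι h) w ∈ U ∧
      ∀ᶠ w' in 𝓝 w, g (coadj (ι h) w') = g w' := by
  have hcont : Continuous fun p : G₀ × (E →L[ℂ] ℂ) => coadj (ι p.1) p.2 :=
    continuous_snd.clm_comp (hι.contMDiff_Ad.continuous.comp continuous_fst)
  have h1 : ∀ᶠ p : G₀ × (E →L[ℂ] ℂ) in 𝓝 (1, w), coadj (ι p.1) p.2 ∈ U := by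
    refine hcont.continuousAt.eventually (hU.mem_nhds ?_)
    change coadj (ι 1) w ∈ U
    rwa [map_one, coadj_one]
  rw [nhds_prod_eq] at h1
  -- A product neighbourhood makes the choice of `h` independent of the point `w'`.
  obtain ⟨N, hN, U', hU', hNU⟩ := eventually_prod_iff.1 h1
  set φ := extChartAt 𝓘(ℝ, E₀) (1 : G₀) with hφ
  have hφ1 : φ.symm (φ 1) = 1 := extChartAt_to_inv 1
  have hφc : ∀ x ∈ φ.target, ContMDiffAt 𝓘(ℝ, E₀) 𝓘(ℝ, E₀) ∞ φ.symm x := fun x hx =>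
    (contMDiffOn_extChartAt_symm (1 : G₀)).contMDiffAt ((isOpen_extChartAt_target 1).mem_nhds hx)
  have h2 : ∀ᶠ x in 𝓝 (φ 1), x ∈ φ.target ∧ N (φ.symm x) := by
    have ht := (hφc _ (mem_extChartAt_target 1)).continuousAt.tendsto
    rw [hφ1] at ht
    filter_upwards [(isOpen_extChartAt_target (I := 𝓘(ℝ, E₀)) (1 : G₀)).mem_nhds
      (mem_extChartAt_target 1), ht.eventually hN] with x hx1 hx2
    exact ⟨hx1, hx2⟩
  obtain ⟨δ, hδ, hball⟩ := Metric.eventually_nhds_iff_ball.1 h2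
  have hconst : ∀ w', U' w' → ∀ x ∈ Metric.ball (φ 1) δ,
      g (coadj (ι (φ.symm x)) w') = g w' := by
    intro w' hw' x hx
    have hd : ∀ y ∈ Metric.ball (φ 1) δ,
        HasFDerivWithinAt (fun y => g (coadj (ι (φ.symm y)) w')) (0 : E₀ →L[ℝ] ℂ)
          (Metric.ball (φ 1) δ) y := by
      intro y hy
      obtain ⟨hy1, hy2⟩ := hball y hy
      have hyU := hNU hy2 hw'
      have hgd : DifferentiableAt ℂ g (coadj (ι (φ.symm y)) w') :=
        hg.holomorphic.differentiableAt (hU.mem_nhds hyU)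
      have hfm := (hι.isOrbitMap w').contMDiff.mdifferentiable (by simp) (φ.symm y)
      have hsm := (hφc y hy1).mdifferentiableAt (by simp)
      have hfd : DifferentiableAt ℝ (fun y => coadj (ι (φ.symm y)) w') y :=
        mdifferentiableAt_iff_differentiableAt.1 
          (MDifferentiableAt.comp (g := fun h => coadj (ι h) w') y hfm hsm)
      have hc := modelDeriv_comp (g := fun h => coadj (ι h) w') (f := φ.symm) y hfm hsm
      rw [modelDeriv_eq_fderiv] at hc
      have hk := (hgd.hasFDerivAt.restrictScalars ℝ).comp y hfd.hasFDerivAt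
      have hz : ((fderiv ℂ g (coadj (ι (φ.symm y)) w')).restrictScalars ℝ).comp
          (fderiv ℝ (fun y => coadj (ι (φ.symm y)) w') y) = 0 := by
        ext v
        rw [hc]
        obtain ⟨X, hX⟩ := (hι.mem_range_modelDeriv_coadj w' (φ.symm y) _).1
          ⟨modelDeriv ℝ E₀ E₀ φ.symm y v, rfl⟩
        change fderiv ℂ g _ (modelDeriv ℝ E₀ (E →L[ℂ] ℂ) (fun h => coadj (ι h) w') (φ.symm y)
          (modelDeriv ℝ E₀ E₀ φ.symm y v)) = 0
        rw [← hX]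
        exact hg.casimir _ hyU _
      rw [hz] at hk
      exact hk.hasFDerivWithinAt
    have := (convex_ball (φ 1) δ).is_const_of_fderivWithin_eq_zero (𝕜 := ℝ)
      (fun y hy => (hd y hy).differentiableWithinAt)
      (fun y hy => (hd y hy).fderivWithin (Metric.isOpen_ball.uniqueDiffWithinAt hy))
      hx (Metric.mem_ball_self hδ)
    simpa only [hφ1, map_one, coadj_one] using this
  have hcφ : ContinuousAt φ 1 := continuousAt_extChartAt 1
  filter_upwards [hN, hcφ.eventually (Metric.ball_mem_nhds _ hδ),
    extChartAt_source_mem_nhds (I := 𝓘(ℝ, E₀)) (1 : G₀)] with h hh1 hh2 hh3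
  refine ⟨hNU hh1 hU'.self_of_nhds, ?_⟩
  filter_upwards [hU'] with w' hw'
  have := hconst w' hw' (φ h) hh2
  rwa [φ.left_inv hh3] at this

/-- The derivative of `g ∘ Ad*(h) = g` at `w` is `dg_{w·h} ∘ Ad*(h) = dg_w`; evaluate it at the
conjugate of `w`, which `Ad*(h)` carries to the conjugate of `w·h`. -/
theorem IsComplexification.tilde_eventually_invariant (hι : IsComplexification E₀ E ι)
    {U : Set (E →L[ℂ] ℂ)} {g : (E →L[ℂ] ℂ) → ℂ} (hU : IsOpen U)
    (hg : IsHolomorphicCasimir G U g) {w : E →L[ℂ] ℂ} (hw : w ∈ U) :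
    ∀ᶠ h in 𝓝 (1 : G₀), hι.tilde g (coadj (ι h) w) = hι.tilde g w := by
  filter_upwards [hι.casimir_eventually_invariant hU hg hw] with h ⟨h1, h2⟩
  have hgd : DifferentiableAt ℂ g (coadjL E (ι h) w) :=
    hg.holomorphic.differentiableAt (hU.mem_nhds h1)
  have h3 := (hgd.hasFDerivAt.comp w (coadjL E (ι h)).hasFDerivAt).fderiv
  have h4 : fderiv ℂ (g ∘ coadjL E (ι h)) w = fderiv ℂ g w := Filter.EventuallyEq.fderiv_eq h2
  rw [h4] at h3
  rw [IsComplexification.tilde, IsComplexification.tilde, hι.conjDual_coadj, h3]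
  rfl

theorem IsComplexification.tilde_invariant (hι : IsComplexification E₀ E ι)
    {U : Set (E →L[ℂ] ℂ)} {g : (E →L[ℂ] ℂ) → ℂ} (hU : IsOpen U)
    (hg : IsHolomorphicCasimir G U g) {z : E →L[ℂ] ℂ} (hz : z ∈ U) {h : G₀}
    (hh : h ∈ connectedComponentIn {h : G₀ | coadj (ι h) z ∈ U} 1) :
    hι.tilde g (coadj (ι h) z) = hι.tilde g z := by
  have : ContinuousMul G₀ := continuousMul_of_contMDiffMul 𝓘(ℝ, E₀) ∞
  have h1 : (1 : G₀) ∈ {h : G₀ | coadj (ι h) z ∈ U} := by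
    change coadj (ι 1) z ∈ U
    rwa [map_one, coadj_one]
  have key : ∀ k ∈ connectedComponentIn {h : G₀ | coadj (ι h) z ∈ U} 1,
      ((fun h => hι.tilde g (coadj (ι h) z) : G₀ → ℂ) : Germ (𝓝 k) ℂ).IsConstant := by
    intro k hk
    have hkU : coadj (ι k) z ∈ U :=
      connectedComponentIn_subset {h : G₀ | coadj (ι h) z ∈ U} 1 hk
    have hev := hι.tilde_eventually_invariant hU hg hkU
    refine ⟨hι.tilde g (coadj (ι k) z), ?_⟩
    -- Left translation by `k⁻¹` moves the question at `k` to the local statement at `1` for the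
    -- point `coadj (ι k) z`.
    have ht : Tendsto (fun y : G₀ => k⁻¹ * y) (𝓝 k) (𝓝 1) := by
      have hc : Continuous fun y : G₀ => k⁻¹ * y := continuous_const.mul continuous_id
      have := hc.tendsto k
      rwa [inv_mul_cancel] at this
    filter_upwards [ht.eventually hev] with y hy
    rw [← coadj_mul, ← map_mul, mul_inv_cancel_left] at hy
    exact hy
  have h2 := eq_of_germ_isConstant_on key isPreconnected_connectedComponentIn hh
    (mem_connectedComponentIn h1)
  simpa only [map_one, coadj_one] using h2

end RealOrbit

/-! ### The orbit of the real group in the orbit of the complex group -/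

section Main

theorem ImmersedSubmanifold.range_modelDeriv_incl {𝕜 : Type} [RCLike 𝕜] {V : Type u}
    [NormedAddCommGroup V] [NormedSpace 𝕜 V] {S : ImmersedSubmanifold 𝕜 V}
    {E : Type*} [NormedAddCommGroup E] [NormedSpace 𝕜 E]
    {H : Type*} [TopologicalSpace H] [ChartedSpace E H] {p : H → S.Carrier} {f : H → V}
    (hp : ContMDiff 𝓘(𝕜, E) 𝓘(𝕜, S.Model) ∞ p)
    (hs : ∀ h, Surjective (modelDeriv 𝕜 E S.Model p h)) (hf : ∀ h, S.incl (p h) = f h) (h : H) :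
    LinearMap.range (modelDeriv 𝕜 S.Model V S.incl (p h)).toLinearMap =
      LinearMap.range (modelDeriv 𝕜 E V f h).toLinearMap := by
  have h1 := modelDeriv_comp (g := S.incl) (f := p) h
    (S.incl_contMDiff.mdifferentiable (by simp) _) (hp.mdifferentiable (by simp) h)
  have h2 : (fun y => S.incl (p y)) = f := funext hf
  rw [h2] at h1
  ext u
  constructor
  · rintro ⟨v, rfl⟩
    obtain ⟨w, rfl⟩ := hs h v
    exact ⟨w, DFunLike.congr_fun h1 w⟩
  · rintro ⟨w, rfl⟩
    exact ⟨_, (DFunLike.congr_fun h1 w).symm⟩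

variable {E₀ : Type*} [NormedAddCommGroup E₀] [NormedSpace ℝ E₀]
  {G₀ : Type*} [TopologicalSpace G₀] [ChartedSpace E₀ G₀] [Group G₀]
  [LieGroup 𝓘(ℝ, E₀) ∞ G₀]
  {E : Type u} [NormedAddCommGroup E] [NormedSpace ℂ E] [FiniteDimensional ℂ E]
  {G : Type*} [TopologicalSpace G] [ChartedSpace E G] [Group G] [LieGroup 𝓘(ℂ, E) ∞ G]
  {ι : G₀ →* G}

/-- The map `j` is smooth because its composite with the submersion `pO` is `pM ∘ ι`. It is an
injective immersion because its composite with the inclusion of `M` is that of `O`. -/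
theorem IsComplexification.isCRIsotropic_of_comp (hι : IsComplexification E₀ E ι)
    {z₀ : E →L[ℂ] ℂ} (hz₀ : z₀ ∉ Sing E G)
    {M : ImmersedSubmanifold ℂ (E →L[ℂ] ℂ)} {O : ImmersedSubmanifold ℝ (E →L[ℂ] ℂ)}
    {pM : G → M.Carrier} {pO : G₀ → O.Carrier} {j : O.Carrier → M.Carrier}
    (hpM : ContMDiff 𝓘(ℂ, E) 𝓘(ℂ, M.Model) ∞ pM)
    (hpO : ContMDiff 𝓘(ℝ, E₀) 𝓘(ℝ, O.Model) ∞ pO) (hOs : Surjective pO)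
    (hOd : ∀ h, Surjective (modelDeriv ℝ E₀ O.Model pO h))
    (hO : ∀ h, O.incl (pO h) = coadj (ι h) z₀)
    (hj : ∀ h, j (pO h) = pM (ι h)) (hji : ∀ y, M.incl (j y) = O.incl y) :
    IsCRIsotropic M.Model O.Model (symplecticForm G M) j := by
  have hjs : ContMDiff 𝓘(ℝ, O.Model) 𝓘(ℝ, M.Model) ∞ j := by
    refine contMDiff_of_comp_submersion hpO hOs hOd ?_
    simp only [hj]
    exact (contMDiff_real_of_complex hpM).comp hι.contMDiff
  have hMi := M.incl_contMDiff.mdifferentiable (by simp)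
  have hd : ∀ y, modelDeriv ℝ O.Model (E →L[ℂ] ℂ) O.incl y =
      ((modelDeriv ℂ M.Model (E →L[ℂ] ℂ) M.incl (j y)).restrictScalars ℝ).comp
        (modelDeriv ℝ O.Model M.Model j y) := by
    intro y
    have h1 := modelDeriv_comp (g := M.incl) (f := j) y
      ((contMDiff_real_of_complex M.incl_contMDiff).mdifferentiable (by simp) _)
      (hjs.mdifferentiable (by simp) y)
    rw [modelDeriv_real_of_complex (hMi _), funext hji] at h1
    exact h1
  have hmap : ∀ y u, u ∈ LinearMap.range (modelDeriv ℝ O.Model (E →L[ℂ] ℂ) O.incl y).toLinearMap ↔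
      ∃ v ∈ realTangent (EM := M.Model) (EL := O.Model) j y,
        modelDeriv ℂ M.Model (E →L[ℂ] ℂ) M.incl (j y) v = u := by
    intro y u
    rw [hd y]
    constructor
    · rintro ⟨v, rfl⟩
      exact ⟨_, ⟨v, rfl⟩, rfl⟩
    · rintro ⟨_, ⟨v, rfl⟩, rfl⟩
      exact ⟨v, rfl⟩
  have hrange : ∀ h, LinearMap.range (modelDeriv ℝ O.Model (E →L[ℂ] ℂ) O.incl (pO h)).toLinearMap =
      LinearMap.range (modelDeriv ℝ E₀ (E →L[ℂ] ℂ) (fun h => coadj (ι h) z₀) h).toLinearMap :=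
    ImmersedSubmanifold.range_modelDeriv_incl hpO hOd hO
  refine ⟨⟨?_, hjs, ?_, ?_⟩, ?_⟩
  · intro y y' h
    apply O.incl_injective
    rw [← hji, ← hji, h]
  · intro y
    have h1 : Injective (modelDeriv ℝ O.Model (E →L[ℂ] ℂ) O.incl y) := O.incl_immersion y
    rw [hd y] at h1
    exact Injective.of_comp h1
  -- The constant dimension is the one at `z₀`: the complex linear map `coadjL E (ι h)` carries the
  -- tangent space of the real orbit at `z₀` onto the one at `coadj (ι h) z₀`.
  · refine ⟨Module.finrank ℂ (holPart (LinearMap.range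
      (modelDeriv ℝ E₀ (E →L[ℂ] ℂ) (fun h => coadj (ι h) z₀) 1).toLinearMap)), fun y => ?_⟩
    obtain ⟨h, rfl⟩ := hOs y
    rw [tangentOneZero, finrank_oneZeroPart]
    rw [← finrank_holPart_of_injective
      (L := (modelDeriv ℂ M.Model (E →L[ℂ] ℂ) M.incl (j (pO h))).toLinearMap)
      (M.incl_immersion _) (hmap (pO h))]
    refine finrank_holPart_of_injective (L := (coadjL E (ι h)).toLinearMap)
      (coadjL_injective (ι h)) fun w => ?_
    rw [hrange h, (hι.isOrbitMap z₀).range_modelDeriv h]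
    rfl
  · intro y
    obtain ⟨h, rfl⟩ := hOs y
    have hreal : ∀ v ∈ realTangent (EM := M.Model) (EL := O.Model) j (pO h),
        ∃ X, sharp G (coadj (ι h) z₀) (differentialAtOne E₀ E ι X) =
          modelDeriv ℂ M.Model (E →L[ℂ] ℂ) M.incl (j (pO h)) v := by
      intro v hv
      have h1 := (hmap (pO h) _).2 ⟨v, hv, rfl⟩
      rw [hrange h] at h1
      exact (hι.mem_range_modelDeriv_coadj z₀ h _).1 h1
    refine oneZeroPart_le_skewOrthogonal ?_
    rintro v ⟨hv, hv'⟩ w ⟨hw, hw'⟩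
    obtain ⟨X, hX⟩ := hreal v hv
    obtain ⟨X', hX'⟩ := hreal _ hv'
    obtain ⟨Y, hY⟩ := hreal w hw
    obtain ⟨Y', hY'⟩ := hreal _ hw'
    rw [map_smul, ← hX] at hX'
    rw [map_smul, ← hY] at hY'
    change leafForm G (M.incl (j (pO h)))
      (modelDeriv ℂ M.Model (E →L[ℂ] ℂ) M.incl (j (pO h)) v)
      (modelDeriv ℂ M.Model (E →L[ℂ] ℂ) M.incl (j (pO h)) w) = 0
    rw [← hX, ← hY, hji, hO, leafForm_sharp]
    exact hι.apply_bracket_eq_zero (coadj_not_mem_Sing hz₀ _) hX' hY'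

end Main

end CoadjointCR

end

open CoadjointCR in
theorem mainTheorem7
    {E₀ : Type*} [NormedAddCommGroup E₀] [NormedSpace ℝ E₀] [FiniteDimensional ℝ E₀]
    {G₀ : Type*} [TopologicalSpace G₀] [ChartedSpace E₀ G₀] [Group G₀]
    [LieGroup 𝓘(ℝ, E₀) ∞ G₀] [SimplyConnectedSpace G₀]
    {E : Type u} [NormedAddCommGroup E] [NormedSpace ℂ E] [FiniteDimensional ℂ E]
    {G : Type*} [TopologicalSpace G] [ChartedSpace E G] [Group G]
    [LieGroup 𝓘(ℂ, E) ∞ G] [SimplyConnectedSpace G]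
    (ι : G₀ →* G) (hι : IsComplexification E₀ E ι) :
    (∀ z₀ : E →L[ℂ] ℂ, z₀ ∉ Sing E G →
      (∃ M : ImmersedSubmanifold ℂ (E →L[ℂ] ℂ), M.IsOrbit E (fun g : G => coadj g z₀)) ∧
      (∃ O : ImmersedSubmanifold ℝ (E →L[ℂ] ℂ), O.IsOrbit E₀ (fun h : G₀ => coadj (ι h) z₀)) ∧
      ∀ (M : ImmersedSubmanifold ℂ (E →L[ℂ] ℂ)) (O : ImmersedSubmanifold ℝ (E →L[ℂ] ℂ)),
        M.IsOrbit E (fun g : G => coadj g z₀) → O.IsOrbit E₀ (fun h : G₀ => coadj (ι h) z₀) →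
        (∀ x : M.Carrier, M.tangentSpace x = charSubspace G (M.incl x)) ∧
        ∃ j : O.Carrier → M.Carrier, (∀ y, M.incl (j y) = O.incl y) ∧
          IsCRIsotropic M.Model O.Model (symplecticForm G M) j) ∧
    (∀ (U : Set (E →L[ℂ] ℂ)) (g : (E →L[ℂ] ℂ) → ℂ), IsOpen U → IsHolomorphicCasimir G U g →
      ∀ z ∈ U, ∀ h ∈ connectedComponentIn {h : G₀ | coadj (ι h) z ∈ U} 1,
        hι.tilde g (coadj (ι h) z) = hι.tilde g z) := by
  have : FiniteDimensional ℝ (E →L[ℂ] ℂ) := FiniteDimensional.complexToReal _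
  refine ⟨fun z₀ hz₀ => ⟨(isOrbitMap_coadj z₀).exists_immersedSubmanifold,
    (hι.isOrbitMap z₀).exists_immersedSubmanifold, ?_⟩,
    fun U g hU hg z hz h hh => hι.tilde_invariant hU hg hz hh⟩
  rintro M O ⟨pM, hMs, hpM, hMd, hM⟩ ⟨pO, hOs, hpO, hOd, hO⟩
  -- The point `y` of `O` is lifted to `G₀` and sent through `ι` to `M`. Injectivity of the
  -- inclusion of `M` makes the result independent of the lift.
  refine ⟨fun x => ?_, fun y => pM (ι (Function.surjInv hOs y)), ?_, ?_⟩
  · obtain ⟨g, rfl⟩ := hMs x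
    rw [hM g, ← range_modelDeriv_coadj]
    exact ImmersedSubmanifold.range_modelDeriv_incl hpM hMd hM g
  · intro y
    rw [hM, ← hO, Function.surjInv_eq hOs]
  · refine hι.isCRIsotropic_of_comp hz₀ hpM hpO hOs hOd hO (fun h => M.incl_injective ?_)
      fun y => ?_
    · rw [hM, hM, ← hO, Function.surjInv_eq hOs, hO]
    · rw [hM, ← hO, Function.surjInv_eq hOs]
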